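/- Let $n\ge 2$ and $2\le p\le\infty$, and let $\Omega\subseteq\mathbb R^n$ denote an arbitrary open set. For a symmetric $n\times n$ matrix $X$ let $\lambda_X$ be its largest eigenvalue, and for a $C^2$ function $\phi$ with Hessian $\mathcal H\phi$ put $$\mathcal D_p\phi=(p-2)\lambda_{\mathcal H\phi}+\Delta\phi\quad(p<\infty),\qquad \mathcal D_\infty\phi=\lambda_{\mathcal H\phi},$$ $$\Delta_p\phi=|\nabla\phi|^{p-2}\Big((p-2)\frac{\nabla\phi\,\mathcal H\phi\,\nabla\phi^T}{|\nabla\phi|^2}+\Delta\phi\Big)\quad(p<\infty),\qquad \Delta_\infty\phi=\nabla\phi\,\mathcal H\phi\,\nabla\phi^T,$$ where $\Delta_2\phi=\Delta\phi$ everywhere and $\Delta_p\phi=0$ at critical points of $\phi$ if $p>2$. For $L=\mathcal D_p$ or $L=\Delta_p$, a function $u\colon\Omega\to(-\infty,\infty]$ satisfies $Lu\le 0$ in the viscosity sense (v.s.) in $\Omega$ if $u$ is lower semicontinuous, $u<\infty$ on a dense subset of $\Omega$, and $L\phi(x_0)\le 0$ whenever $x_0\in\Omega$, $\phi$ is $C^2$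 near $x_0$, $\phi(x_0)=u(x_0)$ and $\phi\le u$ near $x_0$. Symmetrically, $u\colon\Omega\to[-\infty,\infty)$ satisfies $Lu\ge0$ v.s. in $\Omega$ if $u$ is upper semicontinuous, $u>-\infty$ on a dense subset of $\Omega$, and $L\phi(x_0)\ge0$ whenever $x_0\in\Omega$, $\phi$ is $C^2$ near $x_0$, $\phi(x_0)=u(x_0)$ and $\phi\ge u$ near $x_0$. A function is called $p$-superharmonic if $\Delta_pu\le0$ v.s., and subharmonic if $\Delta_2u\ge0$ v.s. A function $u$ on $\mathbb R^n$ is radial if $u(x)=U(|x|)$ for some function $U$ of one variable. Let $$w_{n,p}(x)=\begin{cases}-\frac{p-1}{p-n}|x|^{\frac{p-n}{p-1}},&p\ne n,\ p<\infty,\\-\ln|x|,&p=n,\\-|x|,&p=\infty,\end{cases}$$ with $w_{n,p}(0)=\infty$ if $p\le n$, and the convention $0\cdot\infty=0$. Then the following hold. 1. (Domination) If $\mathcal D_pu\le0$ v.s. in $\Omega$, then $u$ is $p$-superharmonic in $\Omega$. 2. (Sublinearity) If $\mathcal D_pu\le0$ and $\mathcal D_pv\le0$ v.s. in $\mathbb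 R^n$ and $u$ is radial, then $\mathcal D_p[u+v]\le0$ v.s. in $\mathbb R^n$. 3. (Radial equivalence) If $u$ is a radial $p$-superharmonic function in $\mathbb R^n$, then $\mathcal D_pu\le0$ v.s. in $\mathbb R^n$. 4. (Nesting) If $\mathcal D_pu\le0$ v.s. in $\Omega$, then $\mathcal D_qu\le0$ v.s. in $\Omega$ for every $2\le q\le p$. If $u\colon\Omega\to\mathbb R$ is locally concave, then $\mathcal D_qu\le0$ v.s. in $\Omega$ for all $2\le q\le\infty$. If $\mathcal D_pu\ge0$ v.s. in $\Omega$, then $\mathcal D_qu\ge0$ v.s. in $\Omega$ for every $p\le q\le\infty$. If $u$ is subharmonic in $\Omega$, then $\mathcal D_qu\ge0$ v.s. in $\Omega$ for all $2\le q\le\infty$. 5. (Invariance) If $\mathcal D_pu\le0$ v.s. in $\mathbb R^n$, then $\mathcal D_p[u\circ T]\le0$ v.s. in $\mathbb R^n$ for every isometry $T\colon\mathbb R^n\to\mathbb R^n$. 6. (Touching from above) If $u$ is a radial $p$-superharmonic function in $\mathbb R^n$ and $u(x_0)<\infty$, then there are real numbers $C_1\ge0$ and $C_2$ such that $h=C_1w_{n,p}+C_2$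 satisfies $h(x_0)=u(x_0)$ and $h\ge u$ near $x_0$. -/

import Mathlib

open scoped ENNReal Topology Matrix

namespace DominativeLaplace

noncomputable section

/-- The Hessian matrix of `φ` at `x`, with entries `∂²φ / ∂xᵢ∂xⱼ (x)`. -/
def hessian {n : ℕ} (φ : EuclideanSpace ℝ (Fin n) → ℝ) (x : EuclideanSpace ℝ (Fin n)) :
    Matrix (Fin n) (Fin n) ℝ :=
  Matrix.of fun i j =>
    fderiv ℝ (fderiv ℝ φ) x (EuclideanSpace.single i 1) (EuclideanSpace.single j 1)

/-- The largest eigenvalue of a real square matrix. For a symmetric matrix of positive size the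
set of eigenvalues is finite and nonempty, so that the supremum is a maximum. -/
def largestEigenvalue {n : ℕ} (X : Matrix (Fin n) (Fin n) ℝ) : ℝ :=
  sSup {μ : ℝ | Module.End.HasEigenvalue (Matrix.toLin' X) μ}

/-- The dominative `p`-Laplace operator as a function of the gradient `q` (on which it does not
depend) and the Hessian `X`: `(p - 2) λ_X + tr X` for `p < ∞`, and `λ_X` for `p = ∞`, where `λ_X`
is the largest eigenvalue of `X`. -/
def dominativeOp (n : ℕ) (p : ℝ≥0∞) (_q : EuclideanSpace ℝ (Fin n))
    (X : Matrix (Fin n) (Fin n) ℝ) : ℝ :=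
  if p = ∞ then largestEigenvalue X
  else (p.toReal - 2) * largestEigenvalue X + X.trace

/-- The `p`-Laplace operator as a function of the gradient `q` and the Hessian `X`:
`|q|^(p-2) ((p - 2) qᵀXq / |q|² + tr X)` for `p < ∞`, and `qᵀXq` for `p = ∞`.
At `q = 0` this gives `0` for `2 < p`, and it gives `tr X` for `p = 2` and every `q`. -/
def pLaplaceOp (n : ℕ) (p : ℝ≥0∞) (q : EuclideanSpace ℝ (Fin n))
    (X : Matrix (Fin n) (Fin n) ℝ) : ℝ :=
  if p = ∞ then q.ofLp ⬝ᵥ (X *ᵥ q.ofLp)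
  else ‖q‖ ^ (p.toReal - 2) *
    ((p.toReal - 2) * (q.ofLp ⬝ᵥ (X *ᵥ q.ofLp) / ‖q‖ ^ 2) + X.trace)

/-- `u : Ω → (-∞, ∞]` is a viscosity supersolution of `F (∇u, Hu) = 0` in the open set `Ω`,
i.e. `F (∇u, Hu) ≤ 0` in the viscosity sense. Only the values of `u` in `Ω` matter.
`ContDiffAt ℝ 2 φ x₀` says that `φ` is `C²` in a neighbourhood of `x₀`. -/
structure IsViscositySupersolution {n : ℕ}
    (F : EuclideanSpace ℝ (Fin n) → Matrix (Fin n) (Fin n) ℝ → ℝ)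
    (Ω : Set (EuclideanSpace ℝ (Fin n))) (u : EuclideanSpace ℝ (Fin n) → EReal) : Prop where
  ne_bot : ∀ x ∈ Ω, u x ≠ ⊥
  lsc : LowerSemicontinuousOn u Ω
  finite_dense : Ω ⊆ closure {x | x ∈ Ω ∧ u x < ⊤}
  test_below : ∀ x₀ ∈ Ω, ∀ φ : EuclideanSpace ℝ (Fin n) → ℝ, ContDiffAt ℝ 2 φ x₀ →
    (φ x₀ : EReal) = u x₀ → (∀ᶠ x in 𝓝 x₀, (φ x : EReal) ≤ u x) →
    F (gradient φ x₀) (hessian φ x₀) ≤ 0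

/-- `u : Ω → [-∞, ∞)` is a viscosity subsolution of `F (∇u, Hu) = 0` in the open set `Ω`,
i.e. `F (∇u, Hu) ≥ 0` in the viscosity sense. -/
structure IsViscositySubsolution {n : ℕ}
    (F : EuclideanSpace ℝ (Fin n) → Matrix (Fin n) (Fin n) ℝ → ℝ)
    (Ω : Set (EuclideanSpace ℝ (Fin n))) (u : EuclideanSpace ℝ (Fin n) → EReal) : Prop where
  ne_top : ∀ x ∈ Ω, u x ≠ ⊤
  usc : UpperSemicontinuousOn u Ω
  finite_dense : Ω ⊆ closure {x | x ∈ Ω ∧ ⊥ < u x}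
  test_above : ∀ x₀ ∈ Ω, ∀ φ : EuclideanSpace ℝ (Fin n) → ℝ, ContDiffAt ℝ 2 φ x₀ →
    (φ x₀ : EReal) = u x₀ → (∀ᶠ x in 𝓝 x₀, u x ≤ (φ x : EReal)) →
    0 ≤ F (gradient φ x₀) (hessian φ x₀)

/-- `𝒟_p u ≤ 0` in `Ω` in the viscosity sense: `u` is dominative `p`-superharmonic in `Ω`. -/
def DominativeSuperharmonic {n : ℕ} (p : ℝ≥0∞) (Ω : Set (EuclideanSpace ℝ (Fin n)))
    (u : EuclideanSpace ℝ (Fin n) → EReal) : Prop :=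
  IsViscositySupersolution (dominativeOp n p) Ω u

/-- `𝒟_p u ≥ 0` in `Ω` in the viscosity sense. -/
def DominativeSubsolution {n : ℕ} (p : ℝ≥0∞) (Ω : Set (EuclideanSpace ℝ (Fin n)))
    (u : EuclideanSpace ℝ (Fin n) → EReal) : Prop :=
  IsViscositySubsolution (dominativeOp n p) Ω u

/-- `u` is `p`-superharmonic in `Ω`: `Δ_p u ≤ 0` in the viscosity sense. -/
def PSuperharmonic {n : ℕ} (p : ℝ≥0∞) (Ω : Set (EuclideanSpace ℝ (Fin n)))
    (u : EuclideanSpace ℝ (Fin n) → EReal) : Prop :=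
  IsViscositySupersolution (pLaplaceOp n p) Ω u

/-- `u` is `p`-subharmonic in `Ω`: `Δ_p u ≥ 0` in the viscosity sense. For `p = 2` these are the
subharmonic functions. -/
def PSubharmonic {n : ℕ} (p : ℝ≥0∞) (Ω : Set (EuclideanSpace ℝ (Fin n)))
    (u : EuclideanSpace ℝ (Fin n) → EReal) : Prop :=
  IsViscositySubsolution (pLaplaceOp n p) Ω u

/-- `u` is radial: `u x = U |x|` for a function `U` of one variable. -/
def IsRadial {n : ℕ} (u : EuclideanSpace ℝ (Fin n) → EReal) : Prop :=
  ∃ U : ℝ → EReal, ∀ x, u x = U ‖x‖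

/-- `u` is locally concave in `Ω`. -/
def LocallyConcaveOn {n : ℕ} (Ω : Set (EuclideanSpace ℝ (Fin n)))
    (u : EuclideanSpace ℝ (Fin n) → ℝ) : Prop :=
  ∀ x ∈ Ω, ∃ r > 0, Metric.ball x r ⊆ Ω ∧ ConcaveOn ℝ (Metric.ball x r) u

/-- The fundamental solution `w_{n,p}` of the `p`-Laplace equation, for `2 ≤ n` and `2 ≤ p ≤ ∞`,
with its limit value `∞` at the origin when `p ≤ n`. -/
def fundamentalSolution (n : ℕ) (p : ℝ≥0∞) (x : EuclideanSpace ℝ (Fin n)) : EReal :=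
  if p = ∞ then ((-‖x‖ : ℝ) : EReal)
  else if x = 0 ∧ p ≤ n then ⊤
  else if p = n then ((-Real.log ‖x‖ : ℝ) : EReal)
  else ((-((p.toReal - 1) / (p.toReal - n)) *
    ‖x‖ ^ ((p.toReal - n) / (p.toReal - 1)) : ℝ) : EReal)

end

end DominativeLaplace

open DominativeLaplace

/-! Domination, nesting and invariance are pointwise facts about the Hessian `X` of a test function.
Since `λ_X` is the maximum of the Rayleigh quotient, it bounds the term `qᵀXq / |q|²` of the
`p`-Laplacian. Since `tr X ≤ n λ_X`, the sign of `𝒟_p` controls the sign of `λ_X`, on which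
monotonicity in `p` depends. Conjugation by an orthogonal matrix changes neither `λ_X` nor `tr X`.

The other three assertions rest on one fact: a radial `p`-superharmonic function is, off the origin,
a nondecreasing concave function of the fundamental solution `w`. On annuli it lies above `A w + c`
as soon as it does so at the two radii (`PSuperharmonic.comparison_annulus`); this is concavity in
the variable `w`. A supporting line at `x₀` is then a function `h = C w + const` with `C ≥ 0`
touching `u` from above (`PSuperharmonic.exists_support`). At the origin a constant does, because
`u` is radially nonincreasing.

The Hessian of `w` has its largest eigenvalue in the radial direction, the direction of the
gradient, so `𝒟_p h = 0` off the origin. If `φ` touches `u + v` from below at `x₀`, then `φ - h`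
touches `v` from below, and subadditivity of `𝒟_p` gives `𝒟_p φ ≤ 𝒟_p (φ - h) + 𝒟_p h ≤ 0`. Only
`p`-superharmonicity of `u` is needed here, so `v = 0` yields the radial equivalence. -/

namespace DominativeLaplace

/-! ### The largest eigenvalue of a symmetric matrix -/

section LargestEigenvalue

variable {n : ℕ}

lemma hasEigenvalue_toLin'_of_toEuclideanLin {X : Matrix (Fin n) (Fin n) ℝ} {μ : ℝ}
    (h : Module.End.HasEigenvalue (Matrix.toEuclideanLin X) μ) :
    Module.End.HasEigenvalue (Matrix.toLin' X) μ := by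
  obtain ⟨v, hv⟩ := h.exists_hasEigenvector
  refine Module.End.hasEigenvalue_of_hasEigenvector (x := v.ofLp) ⟨?_, ?_⟩
  · have h1 := hv.apply_eq_smul
    rw [Module.End.mem_eigenspace_iff]
    have h2 := congrArg WithLp.ofLp h1
    simpa using h2
  · intro h0
    exact hv.2 (by ext i; simpa using congrFun h0 i)

/-- The supremum of the Rayleigh quotient of a symmetric operator in finite dimension is attained,
at an eigenvector. -/
lemma exists_hasEigenvalue_forall_dotProduct_le (hn : 0 < n) {X : Matrix (Fin n) (Fin n) ℝ}
    (hX : X.IsSymm) :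
    ∃ μ : ℝ, Module.End.HasEigenvalue (Matrix.toLin' X) μ ∧
      ∀ q : EuclideanSpace ℝ (Fin n), q.ofLp ⬝ᵥ (X *ᵥ q.ofLp) ≤ μ * ‖q‖ ^ 2 := by
  have : Nonempty (Fin n) := ⟨⟨0, hn⟩⟩
  have hT : (Matrix.toEuclideanLin X).IsSymmetric :=
    Matrix.isSymmetric_toEuclideanLin_iff.2 (by
      rw [Matrix.IsHermitian, Matrix.conjTranspose_eq_transpose_of_trivial]; exact hX)
  refine ⟨_, hasEigenvalue_toLin'_of_toEuclideanLin hT.hasEigenvalue_iSup_of_finiteDimensional,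
    fun q => ?_⟩
  have key : ∀ x : EuclideanSpace ℝ (Fin n),
      inner ℝ (Matrix.toEuclideanLin X x) x = x.ofLp ⬝ᵥ (X *ᵥ x.ofLp) := by
    intro x
    rw [EuclideanSpace.inner_eq_star_dotProduct]
    simp
  rcases eq_or_ne q 0 with rfl | hq
  · simp
  have hpos : 0 < ‖q‖ ^ 2 := by positivity
  rw [← div_le_iff₀ hpos]
  have hb : BddAbove (Set.range fun x : {x : EuclideanSpace ℝ (Fin n) // x ≠ 0} =>
      RCLike.re (inner ℝ (Matrix.toEuclideanLin X x) (x : EuclideanSpace ℝ (Fin n))) /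
        ‖(x : EuclideanSpace ℝ (Fin n))‖ ^ 2) := by
    refine ⟨‖LinearMap.toContinuousLinearMap (Matrix.toEuclideanLin X)‖, ?_⟩
    rintro _ ⟨⟨x, hx⟩, rfl⟩
    have hx' : 0 < ‖x‖ ^ 2 := by positivity
    simp only [RCLike.re_to_real]
    rw [div_le_iff₀ hx']
    have h1 := real_inner_le_norm (Matrix.toEuclideanLin X x) x
    have h2 := (LinearMap.toContinuousLinearMap (Matrix.toEuclideanLin X)).le_opNorm x
    simp only [LinearMap.coe_toContinuousLinearMap'] at h2
    nlinarith [norm_nonneg x]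
  have := le_ciSup hb ⟨q, hq⟩
  simp only [RCLike.re_to_real, key] at this
  exact this

lemma le_largestEigenvalue {X : Matrix (Fin n) (Fin n) ℝ} {μ : ℝ}
    (h : Module.End.HasEigenvalue (Matrix.toLin' X) μ) : μ ≤ largestEigenvalue X :=
  le_csSup (Module.End.finite_hasEigenvalue _).bddAbove h

lemma dotProduct_mulVec_le_largestEigenvalue (hn : 0 < n) {X : Matrix (Fin n) (Fin n) ℝ}
    (hX : X.IsSymm) (q : EuclideanSpace ℝ (Fin n)) :
    q.ofLp ⬝ᵥ (X *ᵥ q.ofLp) ≤ largestEigenvalue X * ‖q‖ ^ 2 := by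
  obtain ⟨μ, hμ, h⟩ := exists_hasEigenvalue_forall_dotProduct_le hn hX
  exact (h q).trans (by gcongr; exact le_largestEigenvalue hμ)

lemma largestEigenvalue_le (hn : 0 < n) {X : Matrix (Fin n) (Fin n) ℝ} (hX : X.IsSymm) {c : ℝ}
    (h : ∀ q : EuclideanSpace ℝ (Fin n), q.ofLp ⬝ᵥ (X *ᵥ q.ofLp) ≤ c * ‖q‖ ^ 2) :
    largestEigenvalue X ≤ c := by
  obtain ⟨μ, hμ, -⟩ := exists_hasEigenvalue_forall_dotProduct_le hn hX
  refine csSup_le ⟨μ, hμ⟩ fun ν hν => ?_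
  obtain ⟨v, hv⟩ := Module.End.HasEigenvalue.exists_hasEigenvector hν
  have h1 : X *ᵥ v = ν • v := by simpa using hv.apply_eq_smul
  have h2 := h (WithLp.toLp 2 v)
  rw [EuclideanSpace.real_norm_sq_eq] at h2
  simp only [h1, dotProduct_smul, smul_eq_mul] at h2
  have h3 : v ⬝ᵥ v = ∑ i, v i ^ 2 := by simp [dotProduct, sq]
  have h4 : 0 < v ⬝ᵥ v := by
    simpa using Matrix.dotProduct_star_self_pos_iff.2 hv.2
  rw [← h3] at h2
  exact le_of_mul_le_mul_right h2 h4

lemma trace_le_mul_largestEigenvalue (hn : 0 < n) {X : Matrix (Fin n) (Fin n) ℝ}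
    (hX : X.IsSymm) : X.trace ≤ n * largestEigenvalue X := by
  have h : ∀ i, X i i ≤ largestEigenvalue X := fun i => by
    simpa using dotProduct_mulVec_le_largestEigenvalue hn hX (EuclideanSpace.single i 1)
  calc X.trace = ∑ i, X i i := rfl
    _ ≤ ∑ _i : Fin n, largestEigenvalue X := Finset.sum_le_sum fun i _ => h i
    _ = n * largestEigenvalue X := by simp

lemma largestEigenvalue_add_le (hn : 0 < n) {X Y : Matrix (Fin n) (Fin n) ℝ}
    (hX : X.IsSymm) (hY : Y.IsSymm) :
    largestEigenvalue (X + Y) ≤ largestEigenvalue X + largestEigenvalue Y := by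
  refine largestEigenvalue_le hn (hX.add hY) fun q => ?_
  rw [Matrix.add_mulVec, dotProduct_add, add_mul]
  exact add_le_add (dotProduct_mulVec_le_largestEigenvalue hn hX q)
    (dotProduct_mulVec_le_largestEigenvalue hn hY q)

lemma hasEigenvalue_conj {X P : Matrix (Fin n) (Fin n) ℝ} (hP : Pᵀ * P = 1) {μ : ℝ}
    (h : Module.End.HasEigenvalue (Matrix.toLin' X) μ) :
    Module.End.HasEigenvalue (Matrix.toLin' (Pᵀ * X * P)) μ := by
  have hP' : P * Pᵀ = 1 := mul_eq_one_comm.1 hP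
  obtain ⟨v, hv⟩ := h.exists_hasEigenvector
  have h1 : X *ᵥ v = μ • v := by simpa using hv.apply_eq_smul
  refine Module.End.hasEigenvalue_of_hasEigenvector (x := Pᵀ *ᵥ v) ⟨?_, ?_⟩
  · rw [Module.End.mem_eigenspace_iff]
    rw [Matrix.toLin'_apply, Matrix.mul_assoc, ← Matrix.mulVec_mulVec, ← Matrix.mulVec_mulVec,
      Matrix.mulVec_mulVec _ P, hP', Matrix.one_mulVec, h1, Matrix.mulVec_smul]
  · intro h0
    apply hv.2
    rw [← Matrix.one_mulVec v, ← hP', ← Matrix.mulVec_mulVec, h0, Matrix.mulVec_zero]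

lemma largestEigenvalue_conj {X P : Matrix (Fin n) (Fin n) ℝ} (hP : Pᵀ * P = 1) :
    largestEigenvalue (Pᵀ * X * P) = largestEigenvalue X := by
  have hP' : P * Pᵀ = 1 := mul_eq_one_comm.1 hP
  unfold largestEigenvalue
  congr 1
  ext μ
  refine ⟨fun h => ?_, hasEigenvalue_conj hP⟩
  have h2 := hasEigenvalue_conj (P := Pᵀ) (by simpa using hP') h
  have : Pᵀᵀ * (Pᵀ * X * P) * Pᵀ = X := by
    rw [Matrix.transpose_transpose, Matrix.mul_assoc Pᵀ, ← Matrix.mul_assoc, hP', Matrix.one_mul,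
      Matrix.mul_assoc, hP', Matrix.mul_one]
  rwa [this] at h2

lemma dominativeOp_conj {X P : Matrix (Fin n) (Fin n) ℝ} (hP : Pᵀ * P = 1) (p : ℝ≥0∞)
    (q q' : EuclideanSpace ℝ (Fin n)) :
    dominativeOp n p q (Pᵀ * X * P) = dominativeOp n p q' X := by
  have hP' : P * Pᵀ = 1 := mul_eq_one_comm.1 hP
  have ht : (Pᵀ * X * P).trace = X.trace := by
    rw [Matrix.mul_assoc, Matrix.trace_mul_comm, Matrix.mul_assoc, hP', Matrix.mul_one]
  simp only [dominativeOp, largestEigenvalue_conj hP, ht]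

lemma two_le_toReal {p : ℝ≥0∞} (hp : 2 ≤ p) (hp' : p ≠ ∞) : 2 ≤ p.toReal := by
  simpa using ENNReal.toReal_mono hp' hp

lemma dominativeOp_add_le (hn : 0 < n) {p : ℝ≥0∞} (hp : 2 ≤ p)
    {X Y : Matrix (Fin n) (Fin n) ℝ} (hX : X.IsSymm) (hY : Y.IsSymm)
    (q q₁ q₂ : EuclideanSpace ℝ (Fin n)) :
    dominativeOp n p q (X + Y) ≤ dominativeOp n p q₁ X + dominativeOp n p q₂ Y := by
  have h := largestEigenvalue_add_le hn hX hY
  unfold dominativeOp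
  split_ifs with hp'
  · exact h
  · rw [Matrix.trace_add]
    nlinarith [two_le_toReal hp hp']

lemma pLaplaceOp_nonpos_of_dominativeOp_nonpos (hn : 0 < n) {p : ℝ≥0∞} (hp : 2 ≤ p)
    {X : Matrix (Fin n) (Fin n) ℝ} (hX : X.IsSymm) {q : EuclideanSpace ℝ (Fin n)}
    (h : dominativeOp n p q X ≤ 0) : pLaplaceOp n p q X ≤ 0 := by
  have h1 := dotProduct_mulVec_le_largestEigenvalue hn hX q
  unfold dominativeOp at h
  unfold pLaplaceOp
  split_ifs at h ⊢ with hp'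
  · nlinarith [sq_nonneg ‖q‖]
  · have h2 := two_le_toReal hp hp'
    rcases eq_or_ne q 0 with rfl | hq
    -- For `p = 2` the prefactor is `0 ^ 0 = 1`, leaving the trace; for `p > 2` it vanishes.
    · rcases h2.eq_or_lt with h3 | h3
      · rw [← h3] at h ⊢
        simpa using h
      · simp [Real.zero_rpow (sub_pos.2 h3).ne']
    · have h3 : q.ofLp ⬝ᵥ (X *ᵥ q.ofLp) / ‖q‖ ^ 2 ≤ largestEigenvalue X := by
        rwa [div_le_iff₀ (by positivity)]
      refine mul_nonpos_of_nonneg_of_nonpos (by positivity) (le_trans ?_ h)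
      gcongr

/-- If `λ_X ≤ 0`, then `tr X ≤ n λ_X ≤ 0` and both terms are nonpositive for every exponent. If `λ_X
> 0`, the finite-exponent expression increases with `p`, and `p = ∞` is excluded. -/
lemma dominativeOp_nonpos_of_le (hn : 0 < n) {p p' : ℝ≥0∞} (hp : 2 ≤ p') (hpp : p' ≤ p)
    {X : Matrix (Fin n) (Fin n) ℝ} (hX : X.IsSymm) {q : EuclideanSpace ℝ (Fin n)}
    (h : dominativeOp n p q X ≤ 0) : dominativeOp n p' q X ≤ 0 := by
  have ht := trace_le_mul_largestEigenvalue hn hX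
  have hn' : (0 : ℝ) < n := by exact_mod_cast hn
  by_cases h1 : p' = ∞
  · rwa [show p' = p from le_antisymm hpp (by simp [h1])]
  have h2 := two_le_toReal hp h1
  rcases le_or_gt (largestEigenvalue X) 0 with h0 | h0
  · rw [dominativeOp, if_neg h1]
    nlinarith
  · by_cases h3 : p = ∞
    · rw [dominativeOp, if_pos h3] at h
      linarith
    · have h4 := ENNReal.toReal_mono h3 hpp
      rw [dominativeOp, if_neg h3] at h
      rw [dominativeOp, if_neg h1]
      nlinarith

/-- `λ_X < 0` would force `tr X < 0` and a negative operator; hence `λ_X ≥ 0`, and the operator is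
nondecreasing in finite `p`. -/
lemma dominativeOp_nonneg_of_le (hn : 0 < n) {p p' : ℝ≥0∞} (hp : 2 ≤ p) (hpp : p ≤ p')
    {X : Matrix (Fin n) (Fin n) ℝ} (hX : X.IsSymm) {q : EuclideanSpace ℝ (Fin n)}
    (h : 0 ≤ dominativeOp n p q X) : 0 ≤ dominativeOp n p' q X := by
  have ht := trace_le_mul_largestEigenvalue hn hX
  have hn' : (0 : ℝ) < n := by exact_mod_cast hn
  by_cases h1 : p = ∞
  · rwa [← show p = p' from le_antisymm hpp (by simp [h1])]
  have h2 := two_le_toReal hp h1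
  rw [dominativeOp, if_neg h1] at h
  have h0 : 0 ≤ largestEigenvalue X := by
    by_contra! h0
    nlinarith
  by_cases h3 : p' = ∞
  · rwa [dominativeOp, if_pos h3]
  · have h4 := ENNReal.toReal_mono h3 hpp
    rw [dominativeOp, if_neg h3]
    nlinarith

lemma pLaplaceOp_two (q : EuclideanSpace ℝ (Fin n)) (X : Matrix (Fin n) (Fin n) ℝ) :
    pLaplaceOp n 2 q X = dominativeOp n 2 q X := by
  simp [pLaplaceOp, dominativeOp]

end LargestEigenvalue

/-! ### Hessians -/

section Hessian

variable {n : ℕ} {φ ψ : EuclideanSpace ℝ (Fin n) → ℝ} {x : EuclideanSpace ℝ (Fin n)}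

lemma eventually_differentiableAt (h : ContDiffAt ℝ 2 φ x) :
    ∀ᶠ y in 𝓝 x, DifferentiableAt ℝ φ y :=
  (h.eventually (by simp)).mono fun _ hy => hy.differentiableAt (by simp)

lemma differentiableAt_fderiv (h : ContDiffAt ℝ 2 φ x) : DifferentiableAt ℝ (fderiv ℝ φ) x :=
  (h.fderiv_right (m := 1) (by norm_num [one_add_one_eq_two])).differentiableAt (by simp)

lemma hessian_isSymm (h : ContDiffAt ℝ 2 φ x) : (hessian φ x).IsSymm := by
  ext i j
  exact (h.isSymmSndFDerivAt (by simp)).eq _ _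

lemma sum_smul_single (q : EuclideanSpace ℝ (Fin n)) :
    ∑ i, q i • EuclideanSpace.single i (1 : ℝ) = q := by
  simpa using (EuclideanSpace.basisFun (Fin n) ℝ).sum_repr q

lemma dotProduct_hessian_mulVec (φ : EuclideanSpace ℝ (Fin n) → ℝ)
    (x q r : EuclideanSpace ℝ (Fin n)) :
    q.ofLp ⬝ᵥ (hessian φ x *ᵥ r.ofLp) = fderiv ℝ (fderiv ℝ φ) x q r := by
  conv_rhs => rw [← sum_smul_single q, ← sum_smul_single r]
  simp [dotProduct, Matrix.mulVec, hessian, Finset.mul_sum]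
  rw [Finset.sum_comm]
  refine Finset.sum_congr rfl fun i _ => Finset.sum_congr rfl fun j _ => by ring

lemma hessian_add (hφ : ContDiffAt ℝ 2 φ x) (hψ : ContDiffAt ℝ 2 ψ x) :
    hessian (fun y => φ y + ψ y) x = hessian φ x + hessian ψ x := by
  have h1 : fderiv ℝ (fun y => φ y + ψ y) =ᶠ[𝓝 x] fun y => fderiv ℝ φ y + fderiv ℝ ψ y := by
    filter_upwards [eventually_differentiableAt hφ, eventually_differentiableAt hψ] with y h1 h2
    exact fderiv_fun_add h1 h2
  ext i j
  simp only [hessian, Matrix.of_apply, Matrix.add_apply]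
  rw [h1.fderiv_eq, fderiv_fun_add (differentiableAt_fderiv hφ) (differentiableAt_fderiv hψ)]
  rfl

lemma hessian_add_const (φ : EuclideanSpace ℝ (Fin n) → ℝ) (c : ℝ)
    (x : EuclideanSpace ℝ (Fin n)) : hessian (fun y => φ y + c) x = hessian φ x := by
  have h : fderiv ℝ (fun y => φ y + c) = fderiv ℝ φ := funext fun y => fderiv_add_const c
  simp only [hessian, h]

lemma gradient_add_const (φ : EuclideanSpace ℝ (Fin n) → ℝ) (c : ℝ)
    (x : EuclideanSpace ℝ (Fin n)) : gradient (fun y => φ y + c) x = gradient φ x := by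
  simp [gradient]

lemma hasDerivAt_comp_line {y v : EuclideanSpace ℝ (Fin n)} (t : ℝ)
    (h : DifferentiableAt ℝ φ (y + t • v)) :
    HasDerivAt (fun s : ℝ => φ (y + s • v)) (fderiv ℝ φ (y + t • v) v) t := by
  have h1 : HasDerivAt (fun s : ℝ => y + s • v) v t := by
    simpa using ((hasDerivAt_id t).smul_const v).const_add y
  exact h.hasFDerivAt.comp_hasDerivAt t h1

lemma tendsto_add_smul (x v : EuclideanSpace ℝ (Fin n)) :
    Filter.Tendsto (fun t : ℝ => x + t • v) (𝓝 0) (𝓝 x) := by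
  have : Continuous fun t : ℝ => x + t • v := by fun_prop
  simpa using this.tendsto 0

/-- A function whose symmetric second differences in a direction are nonpositive has a
nonpositive second derivative in that direction. -/
lemma fderiv_fderiv_nonpos_of_second_difference (h : ContDiffAt ℝ 2 φ x)
    (v : EuclideanSpace ℝ (Fin n))
    (hd : ∀ᶠ t : ℝ in 𝓝 0, φ (x + t • v) + φ (x + t • (-v)) ≤ 2 * φ x) :
    fderiv ℝ (fderiv ℝ φ) x v v ≤ 0 := by
  by_contra! hpos
  have hdiff : ∀ w, ∀ᶠ t : ℝ in 𝓝 0, DifferentiableAt ℝ φ (x + t • w) := fun w =>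
    (tendsto_add_smul x w).eventually (eventually_differentiableAt h)
  let χ : ℝ → ℝ := fun t => φ (x + t • v) + φ (x + t • (-v))
  have h1 : deriv χ =ᶠ[𝓝 0] fun t => fderiv ℝ φ (x + t • v) v + fderiv ℝ φ (x + t • (-v)) (-v) := by
    filter_upwards [hdiff v, hdiff (-v)] with t h1 h2
    exact ((hasDerivAt_comp_line t h1).add (hasDerivAt_comp_line t h2)).deriv
  have h2 : ∀ w, HasDerivAt (fun t : ℝ => fderiv ℝ φ (x + t • w) w)
      (fderiv ℝ (fderiv ℝ φ) x w w) 0 := by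
    intro w
    have hl : HasDerivAt (fun s : ℝ => x + s • w) w 0 := by
      simpa using ((hasDerivAt_id (0 : ℝ)).smul_const w).const_add x
    have h3 : HasFDerivAt (fderiv ℝ φ) (fderiv ℝ (fderiv ℝ φ) x) (x + (0 : ℝ) • w) := by
      simpa using (differentiableAt_fderiv h).hasFDerivAt
    have h4 := h3.comp_hasDerivAt (0 : ℝ) hl
    simpa using h4.clm_apply (hasDerivAt_const (0 : ℝ) w)
  have h3 : deriv (deriv χ) 0 = 2 * fderiv ℝ (fderiv ℝ φ) x v v := by
    rw [h1.deriv_eq, ((h2 v).fun_add (h2 (-v))).deriv]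
    simp
    ring
  have h4 : deriv χ 0 = 0 := by
    rw [h1.eq_of_nhds]
    simp
  have h5 : ContinuousAt χ 0 := by
    have : ∀ w, ContinuousAt (fun t : ℝ => φ (x + t • w)) 0 := fun w =>
      (hasDerivAt_comp_line 0 (hdiff w).self_of_nhds).continuousAt
    exact (this v).add (this (-v))
  -- The second derivative test makes `0` a local minimum of `χ`, while `hd` makes it a local
  -- maximum. So `χ` is locally constant, against its positive second derivative.
  have h6 := isLocalMin_of_deriv_deriv_pos (f := χ) (x₀ := 0) (by rw [h3]; linarith) h4 h5
  have h7 : χ =ᶠ[𝓝 0] fun _ => 2 * φ x := by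
    filter_upwards [h6, hd] with t h8 h9
    have : χ 0 = 2 * φ x := by simp [χ]; ring
    exact le_antisymm h9 (this ▸ h8)
  have h8 : deriv (deriv χ) 0 = 0 := by
    rw [h7.deriv.deriv_eq]
    simp
  linarith

lemma hessian_comp_affineIsometryEquiv
    (S : EuclideanSpace ℝ (Fin n) ≃ᵃⁱ[ℝ] EuclideanSpace ℝ (Fin n))
    (hφ : ContDiffAt ℝ 2 φ (S x)) :
    ∃ P : Matrix (Fin n) (Fin n) ℝ, Pᵀ * P = 1 ∧
      hessian (φ ∘ S) x = Pᵀ * hessian φ (S x) * P := by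
  let L : EuclideanSpace ℝ (Fin n) →L[ℝ] EuclideanSpace ℝ (Fin n) :=
    S.linearIsometryEquiv.toContinuousLinearEquiv
  have hS : ∀ y, HasFDerivAt S L y := by
    intro y
    have h1 : HasFDerivAt (fun y => L (y - x) + S x) L y := by
      simpa using (L.hasFDerivAt.comp y ((hasFDerivAt_id y).sub_const x)).add_const (S x)
    refine h1.congr_of_eventuallyEq (Filter.Eventually.of_forall fun z => ?_)
    have := S.map_vsub z x
    simp only [vsub_eq_sub] at this
    exact (eq_add_of_sub_eq this.symm : S z = S.linearIsometryEquiv (z - x) + S x)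
  have hcont : Filter.Tendsto S (𝓝 x) (𝓝 (S x)) := S.continuous.tendsto x
  have h1 : fderiv ℝ (φ ∘ S) =ᶠ[𝓝 x] fun y => (fderiv ℝ φ (S y)).comp L := by
    filter_upwards [hcont.eventually (eventually_differentiableAt hφ)] with y hy
    exact (hy.hasFDerivAt.comp y (hS y)).fderiv
  have h2 : ∀ v w, fderiv ℝ (fderiv ℝ (φ ∘ S)) x v w
      = fderiv ℝ (fderiv ℝ φ) (S x) (L v) (L w) := by
    intro v w
    rw [h1.fderiv_eq]
    have h3 : HasFDerivAt (fun y => fderiv ℝ φ (S y)) ((fderiv ℝ (fderiv ℝ φ) (S x)).comp L) x :=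
      (differentiableAt_fderiv hφ).hasFDerivAt.comp x (hS x)
    rw [(h3.clm_comp (hasFDerivAt_const L x)).fderiv]
    simp
  refine ⟨Matrix.of fun k j => L (EuclideanSpace.single j 1) k, ?_, ?_⟩
  · ext i j
    have h3 : inner ℝ (L (EuclideanSpace.single i 1)) (L (EuclideanSpace.single j 1))
        = inner ℝ (EuclideanSpace.single i (1 : ℝ)) (EuclideanSpace.single j (1 : ℝ)) :=
      S.linearIsometryEquiv.inner_map_map _ _
    rw [EuclideanSpace.inner_eq_star_dotProduct] at h3
    simp only [Matrix.mul_apply, Matrix.transpose_apply, Matrix.of_apply, Matrix.one_apply]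
    simp [dotProduct] at h3
    rw [show (∑ k, L (EuclideanSpace.single i 1) k * L (EuclideanSpace.single j 1) k) = _ from
      Finset.sum_congr rfl fun k _ => mul_comm _ _, h3]
    rw [EuclideanSpace.inner_single_left]
    simp
  · ext i j
    have h3 := dotProduct_hessian_mulVec φ (S x) (L (EuclideanSpace.single i 1))
      (L (EuclideanSpace.single j 1))
    rw [← h2] at h3
    rw [Matrix.mul_assoc]
    exact h3.symm

end Hessian

/-! ### Radial functions -/

section Radial

variable {n : ℕ} {Φ Φ₁ : ℝ → ℝ} {Φ₂ : ℝ} {z x : EuclideanSpace ℝ (Fin n)}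

lemma hasFDerivAt_norm_sub_sq (z y : EuclideanSpace ℝ (Fin n)) :
    HasFDerivAt (fun y => ‖y - z‖ ^ 2) (2 • innerSL ℝ (y - z)) y := by
  simpa using ((hasFDerivAt_id y).sub_const z).norm_sq

lemma hasFDerivAt_radial {a : ℝ} {y : EuclideanSpace ℝ (Fin n)}
    (h : HasDerivAt Φ a (‖y - z‖ ^ 2)) :
    HasFDerivAt (fun y => Φ (‖y - z‖ ^ 2)) ((2 * a) • innerSL ℝ (y - z)) y := by
  have := h.comp_hasFDerivAt y (hasFDerivAt_norm_sub_sq z y)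
  convert! this using 1
  ext v
  simp
  ring

lemma gradient_radial (h : HasDerivAt Φ (Φ₁ (‖x - z‖ ^ 2)) (‖x - z‖ ^ 2)) :
    gradient (fun y => Φ (‖y - z‖ ^ 2)) x = (2 * Φ₁ (‖x - z‖ ^ 2)) • (x - z) := by
  rw [gradient, (hasFDerivAt_radial h).fderiv, map_smul]
  congr 1
  exact (InnerProductSpace.toDual ℝ _).symm_apply_apply _

lemma fderiv_fderiv_radial (h₁ : ∀ᶠ s in 𝓝 (‖x - z‖ ^ 2), HasDerivAt Φ (Φ₁ s) s)
    (h₂ : HasDerivAt Φ₁ Φ₂ (‖x - z‖ ^ 2)) (v w : EuclideanSpace ℝ (Fin n)) :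
    fderiv ℝ (fderiv ℝ (fun y => Φ (‖y - z‖ ^ 2))) x v w =
      4 * Φ₂ * inner ℝ (x - z) v * inner ℝ (x - z) w +
        2 * Φ₁ (‖x - z‖ ^ 2) * inner ℝ v w := by
  have hc : Filter.Tendsto (fun y : EuclideanSpace ℝ (Fin n) => ‖y - z‖ ^ 2) (𝓝 x)
      (𝓝 (‖x - z‖ ^ 2)) :=
    (hasFDerivAt_norm_sub_sq z x).continuousAt
  have h3 : fderiv ℝ (fun y => Φ (‖y - z‖ ^ 2)) =ᶠ[𝓝 x]
      fun y => (2 * Φ₁ (‖y - z‖ ^ 2)) • innerSL ℝ (y - z) := by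
    filter_upwards [hc.eventually h₁] with y hy
    exact (hasFDerivAt_radial hy).fderiv
  obtain ⟨B, hB, h4⟩ : ∃ B : EuclideanSpace ℝ (Fin n) →L[ℝ] EuclideanSpace ℝ (Fin n) →L[ℝ] ℝ,
      (∀ v w, B v w = inner ℝ v w) ∧ HasFDerivAt (fun y => innerSL ℝ (y - z)) B x :=
    ⟨innerSL ℝ, fun _ _ => rfl, (innerSL ℝ (E := EuclideanSpace ℝ (Fin n))).hasFDerivAt.comp x
      ((hasFDerivAt_id x).sub_const z)⟩
  rw [h3.fderiv_eq, (((hasFDerivAt_radial h₂).const_mul 2).fun_smul h4).fderiv]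
  simp only [add_apply, ContinuousLinearMap.smulRight_apply, smul_apply,
    innerSL_apply_apply, smul_eq_mul, hB]
  ring

lemma inner_self_single (y : EuclideanSpace ℝ (Fin n)) :
    ∑ i, inner ℝ y (EuclideanSpace.single i (1 : ℝ)) * inner ℝ y (EuclideanSpace.single i (1 : ℝ))
      = ‖y‖ ^ 2 := by
  rw [EuclideanSpace.real_norm_sq_eq]
  simp [sq, EuclideanSpace.inner_single_right]

lemma trace_hessian_radial (h₁ : ∀ᶠ s in 𝓝 (‖x - z‖ ^ 2), HasDerivAt Φ (Φ₁ s) s)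
    (h₂ : HasDerivAt Φ₁ Φ₂ (‖x - z‖ ^ 2)) :
    (hessian (fun y => Φ (‖y - z‖ ^ 2)) x).trace =
      4 * Φ₂ * ‖x - z‖ ^ 2 + 2 * n * Φ₁ (‖x - z‖ ^ 2) := by
  simp only [Matrix.trace, Matrix.diag, hessian, Matrix.of_apply, fderiv_fderiv_radial h₁ h₂,
    Finset.sum_add_distrib, mul_assoc]
  simp only [← Finset.mul_sum, inner_self_single]
  simp
  ring

lemma contDiffAt_radial (h : ContDiffAt ℝ 2 Φ (‖x - z‖ ^ 2)) :
    ContDiffAt ℝ 2 (fun y => Φ (‖y - z‖ ^ 2)) x := by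
  have h1 : ContDiffAt ℝ 2 (fun y : EuclideanSpace ℝ (Fin n) => ‖y - z‖ ^ 2) x :=
    ((contDiff_id.sub contDiff_const).norm_sq ℝ).contDiffAt
  exact h.comp x h1

/-- The gradient is parallel to `x - z`, an eigenvector of the Hessian with eigenvalue `4 Φ₂ |x -
z|² + 2 Φ₁`. Off the critical points only the sign of the bracket matters, and the bracket is linear
in `Φ`. -/
lemma pLaplaceOp_radial_pos {p : ℝ≥0∞} (hx : x ≠ z)
    (h₁ : ∀ᶠ s in 𝓝 (‖x - z‖ ^ 2), HasDerivAt Φ (Φ₁ s) s)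
    (h₂ : HasDerivAt Φ₁ Φ₂ (‖x - z‖ ^ 2)) (hne : Φ₁ (‖x - z‖ ^ 2) ≠ 0)
    (htop : p = ∞ → 0 < 4 * Φ₂ * ‖x - z‖ ^ 2 + 2 * Φ₁ (‖x - z‖ ^ 2))
    (hfin : p ≠ ∞ → 0 < (p.toReal - 1) * (4 * Φ₂ * ‖x - z‖ ^ 2) +
      2 * (p.toReal - 2 + n) * Φ₁ (‖x - z‖ ^ 2)) :
    0 < pLaplaceOp n p (gradient (fun y => Φ (‖y - z‖ ^ 2)) x)
      (hessian (fun y => Φ (‖y - z‖ ^ 2)) x) := by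
  set a := Φ₁ (‖x - z‖ ^ 2) with ha
  have hg := gradient_radial (Φ₁ := Φ₁) h₁.self_of_nhds
  have hr : 0 < ‖x - z‖ := norm_pos_iff.2 (sub_ne_zero.2 hx)
  set q := gradient (fun y => Φ (‖y - z‖ ^ 2)) x with hq
  have hquad : q.ofLp ⬝ᵥ (hessian (fun y => Φ (‖y - z‖ ^ 2)) x *ᵥ q.ofLp) =
      (4 * Φ₂ * ‖x - z‖ ^ 2 + 2 * a) * ‖q‖ ^ 2 := by
    rw [dotProduct_hessian_mulVec, fderiv_fderiv_radial h₁ h₂, hg, ← ha]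
    simp only [inner_smul_left, inner_smul_right, real_inner_self_eq_norm_sq, norm_smul, mul_pow,
      Real.norm_eq_abs, sq_abs]
    simp
    ring
  have hqpos : 0 < ‖q‖ := by
    rw [hg]
    exact norm_pos_iff.2 (smul_ne_zero (mul_ne_zero two_ne_zero hne) (sub_ne_zero.2 hx))
  unfold pLaplaceOp
  split_ifs with h
  · rw [hquad]
    have := htop h
    positivity
  · rw [hquad, trace_hessian_radial h₁ h₂, mul_div_assoc, div_self (by positivity), mul_one, ← ha]
    refine mul_pos (by positivity) (lt_of_lt_of_eq (hfin h) ?_)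
    ring

/-- The tangential eigenvalue is `2 Φ₁`, so `0 ≤ Φ₂` makes the radial eigenvalue the largest, and
`𝒟_p` is bounded by the bracket of the `p`-Laplacian. -/
lemma dominativeOp_radial_nonpos (hn : 0 < n) {p : ℝ≥0∞} (hp : 2 ≤ p)
    (hΦ : ContDiffAt ℝ 2 Φ (‖x - z‖ ^ 2))
    (h₁ : ∀ᶠ s in 𝓝 (‖x - z‖ ^ 2), HasDerivAt Φ (Φ₁ s) s)
    (h₂ : HasDerivAt Φ₁ Φ₂ (‖x - z‖ ^ 2)) (hconv : 0 ≤ Φ₂)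
    (htop : p = ∞ → 4 * Φ₂ * ‖x - z‖ ^ 2 + 2 * Φ₁ (‖x - z‖ ^ 2) ≤ 0)
    (hfin : p ≠ ∞ → (p.toReal - 1) * (4 * Φ₂ * ‖x - z‖ ^ 2) +
      2 * (p.toReal - 2 + n) * Φ₁ (‖x - z‖ ^ 2) ≤ 0) (q : EuclideanSpace ℝ (Fin n)) :
    dominativeOp n p q (hessian (fun y => Φ (‖y - z‖ ^ 2)) x) ≤ 0 := by
  have hl : largestEigenvalue (hessian (fun y => Φ (‖y - z‖ ^ 2)) x) ≤
      4 * Φ₂ * ‖x - z‖ ^ 2 + 2 * Φ₁ (‖x - z‖ ^ 2) := by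
    refine largestEigenvalue_le hn (hessian_isSymm (contDiffAt_radial hΦ)) fun q => ?_
    rw [dotProduct_hessian_mulVec, fderiv_fderiv_radial h₁ h₂, real_inner_self_eq_norm_sq]
    have h3 := sq_le_sq₀ (abs_nonneg _) (by positivity) |>.2 (abs_real_inner_le_norm (x - z) q)
    rw [sq_abs, mul_pow] at h3
    nlinarith
  unfold dominativeOp
  split_ifs with h
  · exact hl.trans (htop h)
  · rw [trace_hessian_radial h₁ h₂]
    have h3 := two_le_toReal hp h
    nlinarith [hfin h]

end Radial

/-! ### The fundamental solution as a function of the squared norm -/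

section Profile

/-- The exponent `γ` for which `-s ^ (-γ) / 2` is the derivative of the fundamental solution with
respect to `s = |x|²`. -/
noncomputable def profileExponent (n : ℕ) (p : ℝ≥0∞) : ℝ :=
  if p = ∞ then 1 / 2 else (p.toReal + n - 2) / (2 * (p.toReal - 1))

variable {n : ℕ} {p : ℝ≥0∞}

lemma profileExponent_pos (hn : 0 < n) (hp : 2 ≤ p) : 0 < profileExponent n p := by
  have hn' : (0 : ℝ) < n := by exact_mod_cast hn
  unfold profileExponent
  split_ifs with h
  · norm_num
  · have := two_le_toReal hp h
    apply div_pos <;> linarith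

lemma two_mul_profileExponent (hp : 2 ≤ p) (h : p ≠ ∞) :
    2 * (p.toReal - 1) * profileExponent n p = p.toReal - 2 + n := by
  have := two_le_toReal hp h
  have h1 : p.toReal - 1 ≠ 0 := by linarith
  rw [profileExponent, if_neg h]
  field_simp
  ring

lemma hasDerivAt_neg_half_rpow (γ : ℝ) {s : ℝ} (hs : 0 < s) :
    HasDerivAt (fun s : ℝ => -(1 / 2) * s ^ (-γ)) (γ / 2 * s ^ (-γ - 1)) s := by
  have := (Real.hasDerivAt_rpow_const (p := -γ) (Or.inl hs.ne')).const_mul (-(1 / 2))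
  exact this.congr_deriv (by ring)

lemma sq_rpow_half {r : ℝ} (hr : 0 ≤ r) (a : ℝ) : (r ^ 2) ^ (a / 2) = r ^ a := by
  rw [← Real.rpow_natCast, ← Real.rpow_mul hr]
  congr 1
  push_cast
  ring

/-- The derivative formula covers the power, logarithmic and `p = ∞` cases at once; later arguments
use only this derivative and the regularity of `g`. -/
lemma exists_profile (hp : 2 ≤ p) :
    ∃ g : ℝ → ℝ, (∀ s, 0 < s → HasDerivAt g (-(1 / 2) * s ^ (-profileExponent n p)) s) ∧
      (∀ s, 0 < s → ContDiffAt ℝ 2 g s) ∧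
      ∀ x : EuclideanSpace ℝ (Fin n), x ≠ 0 → fundamentalSolution n p x = (g (‖x‖ ^ 2) : ℝ) := by
  have hpow : ∀ a c : ℝ, ∀ s : ℝ, 0 < s → ContDiffAt ℝ 2 (fun s : ℝ => c * s ^ a) s :=
    fun a c s hs => contDiffAt_const.mul (Real.contDiffAt_rpow_const_of_ne hs.ne')
  have hder : ∀ a c : ℝ, ∀ s : ℝ, 0 < s → c * a = -(1 / 2) → a - 1 = -profileExponent n p →
      HasDerivAt (fun s : ℝ => c * s ^ a) (-(1 / 2) * s ^ (-profileExponent n p)) s := by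
    intro a c s hs h1 h2
    have := (Real.hasDerivAt_rpow_const (p := a) (Or.inl hs.ne')).const_mul c
    exact this.congr_deriv (by rw [← mul_assoc, h1, h2])
  by_cases h1 : p = ∞
  · refine ⟨fun s => -1 * s ^ ((1 : ℝ) / 2), fun s hs => hder _ _ s hs (by norm_num) ?_,
      hpow _ _, fun x _ => ?_⟩
    · rw [profileExponent, if_pos h1]
      norm_num
    · simp only [fundamentalSolution, if_pos h1, sq_rpow_half (norm_nonneg x)]
      simp
  have h2 := two_le_toReal hp h1
  by_cases h3 : p = n
  · have h4 : p.toReal = n := by simp [h3]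
    refine ⟨fun s => -(1 / 2) * Real.log s, fun s hs => ?_, fun s hs =>
      contDiffAt_const.mul (Real.contDiffAt_log.2 hs.ne'), fun x hx => ?_⟩
    · have : profileExponent n p = 1 := by
        rw [profileExponent, if_neg h1, ← h4]
        have : p.toReal - 1 ≠ 0 := by linarith
        field_simp
        ring
      rw [this, Real.rpow_neg_one]
      exact (Real.hasDerivAt_log hs.ne').const_mul _
    · rw [fundamentalSolution, if_neg h1, if_neg (by simp [hx]), if_pos h3, EReal.coe_eq_coe_iff]
      simp only [Real.log_pow]
      push_cast
      ring
  · have h4 : p.toReal - n ≠ 0 := by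
      intro h
      apply h3
      rw [← ENNReal.ofReal_toReal h1, sub_eq_zero.1 h]
      simp
    have h5 : p.toReal - 1 ≠ 0 := by linarith
    refine ⟨fun s => -((p.toReal - 1) / (p.toReal - n)) *
      s ^ ((p.toReal - n) / (p.toReal - 1) / 2), fun s hs => hder _ _ s hs ?_ ?_,
      hpow _ _, fun x hx => ?_⟩
    · field_simp
    · rw [profileExponent, if_neg h1]
      field_simp
      ring
    · simp only [fundamentalSolution, if_neg h1, hx, false_and, if_false, if_neg h3,
        sq_rpow_half (norm_nonneg x)]

end Profile

/-! ### Comparison with strict classical subsolutions -/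

section Comparison

variable {n : ℕ} {p : ℝ≥0∞} {u : EuclideanSpace ℝ (Fin n) → EReal}

/-- At a negative minimum of `u - φ` over `K`, which must lie in `U`, a vertical translate of `φ` is
a forbidden test function. -/
lemma IsViscositySupersolution.not_lt_of_strict_subsolution
    {F : EuclideanSpace ℝ (Fin n) → Matrix (Fin n) (Fin n) ℝ → ℝ}
    (hu : IsViscositySupersolution F Set.univ u) {K U : Set (EuclideanSpace ℝ (Fin n))}
    (hK : IsCompact K) (hU : IsOpen U) (hUK : U ⊆ K) {φ : EuclideanSpace ℝ (Fin n) → ℝ}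
    (hφ : ContinuousOn φ K) (hφ2 : ∀ x ∈ U, ContDiffAt ℝ 2 φ x)
    (hF : ∀ x ∈ U, 0 < F (gradient φ x) (hessian φ x))
    (hbd : ∀ x ∈ K, x ∉ U → (φ x : EReal) ≤ u x) {x₁ : EuclideanSpace ℝ (Fin n)}
    (hx₁ : x₁ ∈ K) : (φ x₁ : EReal) ≤ u x₁ := by
  by_contra! hlt
  have hlsc : LowerSemicontinuousOn (fun x => u x + ((-φ x : ℝ) : EReal)) K := by
    refine (hu.lsc.mono (Set.subset_univ K)).add' ?_ fun x hx => ?_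
    · exact (continuous_coe_real_ereal.comp_continuousOn hφ.neg).lowerSemicontinuousOn
    · exact EReal.continuousAt_add (Or.inr (by simp)) (Or.inr (by simp))
  obtain ⟨x₀, hx₀, hmin⟩ := hlsc.exists_isMinOn ⟨x₁, hx₁⟩ hK
  have hb : ∀ x, u x ≠ ⊥ := fun x => hu.ne_bot x trivial
  have h1 := hmin hx₁
  simp only [Set.mem_ofPred_eq] at h1
  have hx₁top : u x₁ ≠ ⊤ := hlt.ne_top
  have hx₀top : u x₀ ≠ ⊤ := by
    intro h
    rw [h, EReal.top_add_coe, top_le_iff] at h1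
    exact EReal.add_ne_top hx₁top (EReal.coe_ne_top _) h1
  obtain ⟨a, ha⟩ : ∃ a : ℝ, u x₀ = a := ⟨_, (EReal.coe_toReal hx₀top (hb x₀)).symm⟩
  obtain ⟨b, hb'⟩ : ∃ b : ℝ, u x₁ = b := ⟨_, (EReal.coe_toReal hx₁top (hb x₁)).symm⟩
  rw [ha, hb'] at h1
  rw [hb'] at hlt
  norm_cast at h1 hlt
  have hx₀U : x₀ ∈ U := by
    by_contra h
    have := hbd x₀ hx₀ h
    rw [ha] at this
    norm_cast at this
    linarith
  refine absurd (hu.test_below x₀ trivial (fun y => φ y + (a - φ x₀))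
    ((hφ2 x₀ hx₀U).add contDiffAt_const) (by rw [ha]; norm_cast; ring) ?_) ?_
  · filter_upwards [hU.mem_nhds hx₀U] with x hx
    have h2 := hmin (hUK hx)
    simp only [Set.mem_ofPred_eq, ha] at h2
    rcases eq_or_ne (u x) ⊤ with h | h
    · rw [h]; exact le_top
    · rw [← EReal.coe_toReal h (hb x)] at h2 ⊢
      norm_cast at h2 ⊢
      linarith
  · rw [gradient_add_const, hessian_add_const]
    exact not_le.2 (hF x₀ hx₀U)

/-- The minimum principle on balls, for radial functions. -/
lemma PSuperharmonic.anti_norm (hp : 2 ≤ p) (hu : PSuperharmonic p Set.univ u)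
    (hr : IsRadial u) {x y : EuclideanSpace ℝ (Fin n)} (hxy : ‖x‖ < ‖y‖) : u y ≤ u x := by
  have hn : (0 : ℝ) ≤ n := Nat.cast_nonneg n
  obtain ⟨U, hU⟩ := hr
  by_contra! hlt
  obtain ⟨m, hm1, hm2⟩ := EReal.lt_iff_exists_real_btwn.1 hlt
  have hy : 0 < ‖y‖ := (norm_nonneg x).trans_lt hxy
  obtain ⟨b, hb⟩ : ∃ b : ℝ, u x = b :=
    ⟨_, (EReal.coe_toReal hm1.ne_top (hu.ne_bot x trivial)).symm⟩
  rw [hb, EReal.coe_lt_coe_iff] at hm1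
  -- The barrier is a paraboloid centred outside the ball of radius `‖y‖`, so that its gradient does
  -- not vanish there.
  set z : EuclideanSpace ℝ (Fin n) := (2 : ℝ) • y with hz
  have hnz : ‖z‖ = 2 * ‖y‖ := by rw [hz, norm_smul]; norm_num
  -- As `‖w - z‖ ≤ 3 * ‖y‖` on the ball, the barrier is at most `m` there, yet at `x` it is at least
  -- `m - 9/10 * (m - b) > b`.
  set δ : ℝ := (m - b) / (10 * ‖y‖ ^ 2) with hδ
  have hδpos : 0 < δ := div_pos (sub_pos.2 hm1) (by positivity)
  let Φ : ℝ → ℝ := fun s => δ * s + (m - 9 * δ * ‖y‖ ^ 2)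
  have hΦ : ∀ s, HasDerivAt Φ δ s := fun s => by
    exact (((hasDerivAt_id s).const_mul δ).add_const _).congr_deriv (mul_one δ)
  have hΦ2 : ContDiff ℝ 2 Φ := by fun_prop
  have hle : ∀ w : EuclideanSpace ℝ (Fin n), ‖w‖ ≤ ‖y‖ → Φ (‖w - z‖ ^ 2) ≤ m := by
    intro w hw
    have h1 : ‖w - z‖ ≤ 3 * ‖y‖ := by linarith [norm_sub_le w z]
    have h2 : ‖w - z‖ ^ 2 ≤ 9 * ‖y‖ ^ 2 := by nlinarith [norm_nonneg (w - z)]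
    simp only [Φ]
    nlinarith
  have hne : ∀ w : EuclideanSpace ℝ (Fin n), ‖w‖ < ‖y‖ → w ≠ z := by
    rintro w hw rfl
    linarith
  have key := IsViscositySupersolution.not_lt_of_strict_subsolution hu
    (isCompact_closedBall (0 : EuclideanSpace ℝ (Fin n)) ‖y‖) Metric.isOpen_ball
    Metric.ball_subset_closedBall (φ := fun w => Φ (‖w - z‖ ^ 2))
    (by fun_prop) (fun w _ => contDiffAt_radial hΦ2.contDiffAt) ?_ ?_ (x₁ := x)
    (by simpa using hxy.le)
  · rw [hb, EReal.coe_le_coe_iff] at key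
    have h3 : 9 * δ * ‖y‖ ^ 2 = 9 / 10 * (m - b) := by
      rw [hδ]; field_simp
    have h4 : 0 ≤ δ * ‖x - z‖ ^ 2 := by positivity
    simp only [Φ] at key
    linarith
  · intro w hw
    have hw' := hne w (by simpa using hw)
    have hpos : 0 < ‖w - z‖ := norm_pos_iff.2 (sub_ne_zero.2 hw')
    refine pLaplaceOp_radial_pos (Φ₁ := fun _ => δ) (Φ₂ := 0) hw'
      (Filter.Eventually.of_forall hΦ) (hasDerivAt_const _ _) hδpos.ne' (fun _ => by simpa) ?_
    intro h
    have := two_le_toReal hp h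
    have hn' : (0 : ℝ) < n := by
      rcases Nat.eq_zero_or_pos n with rfl | h
      · exact absurd (Subsingleton.elim w z) hw'
      · exact_mod_cast h
    simp only [mul_zero, zero_mul, zero_add]
    have : 0 < p.toReal - 2 + n := by linarith
    positivity
  · intro w hw hw'
    have : ‖w‖ = ‖y‖ := le_antisymm (by simpa using hw) (by simpa using hw')
    rw [hU w, this, ← hU y]
    exact le_trans (by exact_mod_cast hle w this.le) hm2.le

/-- Density gives a point of finiteness closer to the origin than `x`, and radial monotonicity
carries the bound outwards. -/
lemma PSuperharmonic.lt_top_of_radial (hp : 2 ≤ p)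
    (hu : PSuperharmonic p Set.univ u) (hr : IsRadial u) {x : EuclideanSpace ℝ (Fin n)}
    (hx : x ≠ 0) : u x < ⊤ := by
  by_contra! htop
  rw [top_le_iff] at htop
  have h0 : (0 : EuclideanSpace ℝ (Fin n)) ∈ closure {x | x ∈ Set.univ ∧ u x < ⊤} :=
    hu.finite_dense trivial
  obtain ⟨y, hy, hy'⟩ := mem_closure_iff.1 h0 (Metric.ball 0 ‖x‖) Metric.isOpen_ball
    (by simpa using hx)
  have := hu.anti_norm hp hr (x := y) (y := x) (by simpa using hy)
  rw [htop, top_le_iff] at this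
  exact hy'.2.ne this

end Comparison

/-! ### Touching radial `p`-superharmonic functions from above -/

section Touching

variable {n : ℕ} {p : ℝ≥0∞} {u v : EuclideanSpace ℝ (Fin n) → EReal} {g : ℝ → ℝ}

/-- The bracket of the radial operator annihilates the fundamental solution. What remains is the
contribution of `ε * s`: strictly positive for the comparison, zero for the touching function. -/
lemma profile_top_identity (h : p = ∞) {s : ℝ} (hs : 0 < s) (A ε : ℝ) :
    4 * (A * (profileExponent n p / 2 * s ^ (-profileExponent n p - 1))) * s +
      2 * (A * (-(1 / 2) * s ^ (-profileExponent n p)) + ε) = 2 * ε := by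
  rw [Real.rpow_sub_one hs.ne', profileExponent, if_pos h]
  field_simp
  ring

lemma profile_finite_identity (hp : 2 ≤ p) (h : p ≠ ∞) {s : ℝ} (hs : 0 < s) (A ε : ℝ) :
    (p.toReal - 1) * (4 * (A * (profileExponent n p / 2 * s ^ (-profileExponent n p - 1))) * s) +
      2 * (p.toReal - 2 + n) * (A * (-(1 / 2) * s ^ (-profileExponent n p)) + ε) =
      2 * (p.toReal - 2 + n) * ε := by
  have h1 := two_mul_profileExponent (n := n) hp h
  have h2 : s ^ (-profileExponent n p - 1) * s = s ^ (-profileExponent n p) := by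
    rw [Real.rpow_sub_one hs.ne', div_mul_cancel₀ _ hs.ne']
  linear_combination (2 * (p.toReal - 1) * A * profileExponent n p) * h2 +
    A * s ^ (-profileExponent n p) * h1

lemma hasDerivAt_affine_profile {γ : ℝ}
    (hg : ∀ s, 0 < s → HasDerivAt g (-(1 / 2) * s ^ (-γ)) s) (A ε c : ℝ) {s : ℝ} (hs : 0 < s) :
    HasDerivAt (fun s => A * g s + ε * s + c) (A * (-(1 / 2) * s ^ (-γ)) + ε) s :=
  ((((hg s hs).const_mul A).add ((hasDerivAt_id s).const_mul ε)).add_const c).congr_deriv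
    (by rw [mul_one])

lemma profile_strictAntiOn {γ : ℝ} (hg : ∀ s, 0 < s → HasDerivAt g (-(1 / 2) * s ^ (-γ)) s) :
    StrictAntiOn g (Set.Ioi 0) := by
  refine strictAntiOn_of_deriv_neg (convex_Ioi 0)
    (fun s hs => (hg s hs).continuousAt.continuousWithinAt) fun s hs => ?_
  rw [interior_Ioi] at hs
  rw [(hg s hs).deriv]
  have := Real.rpow_pos_of_pos hs (-γ)
  linarith

/-- Comparison on annuli of radial `p`-superharmonic functions with fundamental solutions. -/
lemma PSuperharmonic.comparison_annulus (hn : 0 < n) (hp : 2 ≤ p)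
    (hu : PSuperharmonic p Set.univ u) (hr : IsRadial u)
    (hg : ∀ s, 0 < s → HasDerivAt g (-(1 / 2) * s ^ (-profileExponent n p)) s)
    (hg2 : ∀ s, 0 < s → ContDiffAt ℝ 2 g s) {A c : ℝ} (hA : 0 < A)
    {x y z : EuclideanSpace ℝ (Fin n)} (hx : x ≠ 0) (hxy : ‖x‖ ≤ ‖y‖) (hyz : ‖y‖ ≤ ‖z‖)
    (h1 : ((A * g (‖x‖ ^ 2) + c : ℝ) : EReal) ≤ u x)
    (h2 : ((A * g (‖z‖ ^ 2) + c : ℝ) : EReal) ≤ u z) :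
    ((A * g (‖y‖ ^ 2) + c : ℝ) : EReal) ≤ u y := by
  have hγ := profileExponent_pos hn hp
  obtain ⟨U, hU⟩ := hr
  by_contra! hlt
  obtain ⟨m, hm1, hm2⟩ := EReal.lt_iff_exists_real_btwn.1 hlt
  rw [EReal.coe_lt_coe_iff] at hm2
  have hx0 : 0 < ‖x‖ := norm_pos_iff.2 hx
  have hz0 : 0 < ‖z‖ := by linarith
  -- The first bound keeps the gradient of the perturbed barrier nonzero up to radius `‖z‖`; the
  -- second keeps its value at `y` at least `m`.
  obtain ⟨ε, hε, hε1, hε2⟩ : ∃ ε : ℝ, 0 < ε ∧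
      ε < A * (1 / 2 * (‖z‖ ^ 2) ^ (-profileExponent n p)) ∧
      ε * ‖z‖ ^ 2 ≤ A * g (‖y‖ ^ 2) + c - m := by
    have hpos : 0 < A * (1 / 2 * (‖z‖ ^ 2) ^ (-profileExponent n p)) := by positivity
    have hpos2 : 0 < (A * g (‖y‖ ^ 2) + c - m) / ‖z‖ ^ 2 := div_pos (sub_pos.2 hm2) (by positivity)
    refine ⟨min (A * (1 / 2 * (‖z‖ ^ 2) ^ (-profileExponent n p)) / 2)
      ((A * g (‖y‖ ^ 2) + c - m) / ‖z‖ ^ 2), lt_min (half_pos hpos) hpos2,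
      (min_le_left _ _).trans_lt (half_lt_self hpos), ?_⟩
    rw [← le_div_iff₀ (by positivity)]
    exact min_le_right _ _
  let Φ : ℝ → ℝ := fun s => A * g s + ε * s + (c - ε * ‖z‖ ^ 2)
  have hΦ : ∀ s, 0 < s → HasDerivAt Φ (A * (-(1 / 2) * s ^ (-profileExponent n p)) + ε) s :=
    fun s hs => hasDerivAt_affine_profile hg A ε _ hs
  have hΦ2 : ∀ s, 0 < s → ContDiffAt ℝ 2 Φ s := fun s hs =>
    ((contDiffAt_const.mul (hg2 s hs)).add (contDiffAt_const.mul contDiffAt_id)).add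
      contDiffAt_const
  have hsq : ∀ w : EuclideanSpace ℝ (Fin n), ‖x‖ ≤ ‖w‖ → 0 < ‖w - 0‖ ^ 2 := by
    intro w hw
    rw [sub_zero]
    have := hx0.trans_le hw
    positivity
  have hreg : ∀ w : EuclideanSpace ℝ (Fin n), ‖x‖ ≤ ‖w‖ →
      ContDiffAt ℝ 2 (fun w => Φ (‖w - 0‖ ^ 2)) w := fun w hw =>
    contDiffAt_radial (hΦ2 _ (hsq w hw))
  have hcont : Continuous fun w : EuclideanSpace ℝ (Fin n) => ‖w‖ := continuous_norm
  have key := IsViscositySupersolution.not_lt_of_strict_subsolution hu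
    (K := {w | ‖x‖ ≤ ‖w‖} ∩ Metric.closedBall 0 ‖z‖)
    (U := {w | ‖x‖ < ‖w‖} ∩ Metric.ball 0 ‖z‖)
    ((isCompact_closedBall _ _).inter_left (isClosed_le continuous_const hcont))
    ((isOpen_lt continuous_const hcont).inter Metric.isOpen_ball)
    (Set.inter_subset_inter (fun w (hw : ‖x‖ < ‖w‖) => hw.le) Metric.ball_subset_closedBall)
    (φ := fun w => Φ (‖w - 0‖ ^ 2))
    (fun w hw => (hreg w hw.1).continuousAt.continuousWithinAt)
    (fun w hw => hreg w (le_of_lt hw.1)) ?_ ?_ (x₁ := y)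
    ⟨hxy, by simpa using hyz⟩
  · have h3 : m ≤ Φ (‖y - 0‖ ^ 2) := by
      rw [sub_zero]
      have : 0 ≤ ε * ‖y‖ ^ 2 := by positivity
      simp only [Φ]
      linarith
    exact absurd ((EReal.coe_le_coe_iff.2 h3).trans key) (not_le.2 hm1)
  · rintro w ⟨hw1, hw2⟩
    have hw1' : ‖x‖ < ‖w‖ := hw1
    have hw2' : ‖w‖ < ‖z‖ := by simpa using hw2
    have hs := hsq w hw1'.le
    have hs' : ‖w - 0‖ ^ 2 ≤ ‖z‖ ^ 2 := by
      rw [sub_zero]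
      gcongr
    refine pLaplaceOp_radial_pos
      (Φ₁ := fun s => A * (-(1 / 2) * s ^ (-profileExponent n p)) + ε)
      (Φ₂ := A * (profileExponent n p / 2 * (‖w - 0‖ ^ 2) ^ (-profileExponent n p - 1)))
      (norm_pos_iff.1 (hx0.trans hw1'))
      ((eventually_gt_nhds hs).mono fun s hs => hΦ s hs)
      (((hasDerivAt_neg_half_rpow _ hs).const_mul A).add_const ε) ?_ ?_ ?_
    · have h3 : (‖z‖ ^ 2) ^ (-profileExponent n p) ≤ (‖w - 0‖ ^ 2) ^ (-profileExponent n p) :=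
        Real.rpow_le_rpow_of_nonpos hs hs' (by linarith)
      have h4 := mul_le_mul_of_nonneg_left h3 hA.le
      apply ne_of_lt
      linarith
    · intro h
      simp only [profile_top_identity h hs]
      positivity
    · intro h
      simp only [profile_finite_identity hp h hs]
      have h3 := two_le_toReal hp h
      have h4 : (0 : ℝ) < n := by exact_mod_cast hn
      have : 0 < p.toReal - 2 + n := by linarith
      positivity
  · rintro w ⟨hw1, hw2⟩ hw3
    have hw1' : ‖x‖ ≤ ‖w‖ := hw1
    have hw2' : ‖w‖ ≤ ‖z‖ := by simpa using hw2
    rw [sub_zero]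
    rcases hw1'.eq_or_lt with h | h
    · rw [hU w, ← h, ← hU x]
      refine le_trans (EReal.coe_le_coe_iff.2 ?_) h1
      have : ε * ‖x‖ ^ 2 ≤ ε * ‖z‖ ^ 2 := by gcongr; linarith
      simp only [Φ]
      linarith
    · have h3 : ‖w‖ = ‖z‖ := by
        refine le_antisymm hw2' (not_lt.1 fun h3 => hw3 ⟨h, by simpa using h3⟩)
      rw [hU w, h3, ← hU z]
      refine le_trans (EReal.coe_le_coe_iff.2 (le_of_eq ?_)) h2
      simp only [Φ]
      ring

/-- A radial `p`-superharmonic function is a concave function of the fundamental solution, and so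
it has a supporting multiple of the fundamental solution at each point off the origin. -/
lemma PSuperharmonic.exists_support (hn : 0 < n) (hp : 2 ≤ p)
    (hu : PSuperharmonic p Set.univ u) (hr : IsRadial u)
    (hg : ∀ s, 0 < s → HasDerivAt g (-(1 / 2) * s ^ (-profileExponent n p)) s)
    (hg2 : ∀ s, 0 < s → ContDiffAt ℝ 2 g s) {x₀ : EuclideanSpace ℝ (Fin n)} (hx₀ : x₀ ≠ 0) :
    ∃ C : ℝ, 0 ≤ C ∧ ∀ x, x ≠ 0 →
      u x ≤ (((u x₀).toReal + C * (g (‖x‖ ^ 2) - g (‖x₀‖ ^ 2)) : ℝ) : EReal) := by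
  have hV : ∀ x, x ≠ 0 → u x = ((u x).toReal : ℝ) := fun x hx =>
    (EReal.coe_toReal (hu.lt_top_of_radial hp hr hx).ne (hu.ne_bot x trivial)).symm
  set V : EuclideanSpace ℝ (Fin n) → ℝ := fun x => (u x).toReal with hVdef
  set G : EuclideanSpace ℝ (Fin n) → ℝ := fun x => g (‖x‖ ^ 2) with hGdef
  have hG : ∀ x y : EuclideanSpace ℝ (Fin n), x ≠ 0 → ‖x‖ < ‖y‖ → G y < G x := by
    intro x y hx hxy
    have hx0 := norm_pos_iff.2 hx
    exact profile_strictAntiOn hg (show 0 < ‖x‖ ^ 2 by positivity)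
      (show 0 < ‖y‖ ^ 2 by have := hx0.trans hxy; positivity) (by gcongr)
  have hVanti : ∀ x y : EuclideanSpace ℝ (Fin n), x ≠ 0 → ‖x‖ < ‖y‖ → V y ≤ V x := by
    intro x y hx hxy
    have hy : y ≠ 0 := norm_pos_iff.1 ((norm_pos_iff.2 hx).trans hxy)
    have := hu.anti_norm hp hr hxy
    rwa [hV x hx, hV y hy, EReal.coe_le_coe_iff] at this
  have hslope : ∀ x z : EuclideanSpace ℝ (Fin n), x ≠ 0 → ‖x‖ < ‖x₀‖ → ‖x₀‖ < ‖z‖ →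
      (V x - V x₀) / (G x - G x₀) ≤ (V x₀ - V z) / (G x₀ - G z) := by
    intro x z hx h1 h2
    have hz : z ≠ 0 := norm_pos_iff.1 ((norm_pos_iff.2 hx₀).trans h2)
    have hG1 := hG x x₀ hx h1
    have hG2 := hG x₀ z hx₀ h2
    have hV1 := hVanti x x₀ hx h1
    have hV2 := hVanti x₀ z hx₀ h2
    rw [div_le_div_iff₀ (by linarith) (by linarith)]
    -- The comparison needs a positive coefficient. If `V x = V z`, monotonicity makes both slopes
    -- zero.
    rcases (hV2.trans hV1).eq_or_lt with h | h
    · rw [show V x = V x₀ by linarith, show V x₀ = V z by linarith]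
      simp
    · have hA : 0 < (V x - V z) / (G x - G z) := div_pos (by linarith) (by linarith)
      have hne : G x - G z ≠ 0 := by linarith
      have := hu.comparison_annulus hn hp hr hg hg2 hA
        (c := V z - (V x - V z) / (G x - G z) * G z) hx h1.le h2.le
        (by
          rw [hV x hx, EReal.coe_le_coe_iff]
          apply le_of_eq
          change (V x - V z) / (G x - G z) * G x + _ = V x
          field_simp
          ring)
        (by
          rw [hV z hz, EReal.coe_le_coe_iff]
          apply le_of_eq
          change (V x - V z) / (G x - G z) * G z + _ = V z
          ring)
      rw [hV x₀ hx₀, EReal.coe_le_coe_iff] at this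
      change (V x - V z) / (G x - G z) * G x₀ + _ ≤ V x₀ at this
      have h3 : (V x - V z) / (G x - G z) * (G x₀ - G z) ≤ V x₀ - V z := by linarith
      rw [div_mul_eq_mul_div, div_le_iff₀ (by linarith)] at h3
      nlinarith
  have hnorm : 0 < ‖x₀‖ := norm_pos_iff.2 hx₀
  -- These are the slopes of `V` against `G` towards smaller radii; their supremum is the slope of a
  -- supporting line.
  set S : Set ℝ := {t | ∃ x, x ≠ 0 ∧ ‖x‖ < ‖x₀‖ ∧ t = (V x - V x₀) / (G x - G x₀)} with hS
  have hbd : ∀ z : EuclideanSpace ℝ (Fin n), ‖x₀‖ < ‖z‖ →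
      ∀ t ∈ S, t ≤ (V x₀ - V z) / (G x₀ - G z) := by
    rintro z hz t ⟨x, hx, hx1, rfl⟩
    exact hslope x z hx hx1 hz
  have hne : S.Nonempty := by
    refine ⟨_, (1 / 2 : ℝ) • x₀, smul_ne_zero (by norm_num) hx₀, ?_, rfl⟩
    rw [norm_smul]
    norm_num
    linarith
  have hbdd : BddAbove S := by
    refine ⟨_, hbd ((2 : ℝ) • x₀) ?_⟩
    rw [norm_smul]
    norm_num
    linarith
  refine ⟨sSup S, Real.sSup_nonneg ?_, fun x hx => ?_⟩
  · rintro t ⟨x, hx, hx1, rfl⟩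
    exact div_nonneg (sub_nonneg.2 (hVanti x x₀ hx hx1)) (sub_nonneg.2 (hG x x₀ hx hx1).le)
  · rw [hV x hx, EReal.coe_le_coe_iff]
    change V x ≤ V x₀ + sSup S * (G x - G x₀)
    rcases lt_trichotomy ‖x‖ ‖x₀‖ with h | h | h
    · have h1 := le_csSup hbdd ⟨x, hx, h, rfl⟩
      rw [div_le_iff₀ (sub_pos.2 (hG x x₀ hx h))] at h1
      linarith
    · obtain ⟨U, hU⟩ := hr
      have h1 : V x = V x₀ := by simp only [hVdef, hU x, hU x₀, h]
      have h2 : G x = G x₀ := by simp only [hGdef, h]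
      rw [h1, h2]
      simp
    · have h1 := csSup_le hne (hbd x h)
      rw [le_div_iff₀ (sub_pos.2 (hG x₀ x hx₀ h))] at h1
      linarith

lemma PSuperharmonic.le_zero_of_radial (hp : 2 ≤ p) (hu : PSuperharmonic p Set.univ u)
    (hr : IsRadial u) (x : EuclideanSpace ℝ (Fin n)) : u x ≤ u 0 := by
  rcases eq_or_ne x 0 with rfl | hx
  · exact le_rfl
  · exact hu.anti_norm hp hr (by simpa using hx)

/-- Radial `p`-superharmonic functions are touched from above by fundamental solutions. -/
lemma PSuperharmonic.exists_fundamentalSolution_touching (hn : 0 < n) (hp : 2 ≤ p)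
    (hu : PSuperharmonic p Set.univ u) (hr : IsRadial u) {x₀ : EuclideanSpace ℝ (Fin n)}
    (hx₀ : u x₀ < ⊤) :
    ∃ C₁ C₂ : ℝ, 0 ≤ C₁ ∧
      (C₁ : EReal) * fundamentalSolution n p x₀ + (C₂ : EReal) = u x₀ ∧
      ∀ᶠ x in 𝓝 x₀, u x ≤ (C₁ : EReal) * fundamentalSolution n p x + (C₂ : EReal) := by
  have hreal : ((u x₀).toReal : EReal) = u x₀ := EReal.coe_toReal hx₀.ne (hu.ne_bot x₀ trivial)
  rcases eq_or_ne x₀ 0 with rfl | h0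
  -- With `C₁ = 0` the convention `0 * ⊤ = 0` removes the possibly infinite value of the fundamental
  -- solution at the origin.
  · refine ⟨0, (u 0).toReal, le_rfl, by simpa using hreal, Filter.Eventually.of_forall fun x => ?_⟩
    rw [hreal]
    simpa using hu.le_zero_of_radial hp hr x
  · obtain ⟨g, hg, hg2, hgw⟩ := exists_profile (n := n) hp
    obtain ⟨C, hC, h⟩ := hu.exists_support hn hp hr hg hg2 h0
    refine ⟨C, (u x₀).toReal - C * g (‖x₀‖ ^ 2), hC, ?_, ?_⟩
    · rw [hgw x₀ h0]
      nth_rw 2 [← hreal]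
      norm_cast
      ring
    · filter_upwards [isOpen_ne.mem_nhds h0] with x hx
      refine (h x hx).trans (le_of_eq ?_)
      rw [hgw x hx]
      norm_cast
      ring

/-- Radial `p`-superharmonic functions are touched from above by smooth functions whose
dominative `p`-Laplacian is nonpositive. -/
lemma PSuperharmonic.exists_contDiffAt_touching (hn : 0 < n) (hp : 2 ≤ p)
    (hu : PSuperharmonic p Set.univ u) (hr : IsRadial u) {x₀ : EuclideanSpace ℝ (Fin n)}
    (hx₀ : u x₀ < ⊤) :
    ∃ h : EuclideanSpace ℝ (Fin n) → ℝ, ContDiffAt ℝ 2 h x₀ ∧ (h x₀ : EReal) = u x₀ ∧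
      (∀ᶠ x in 𝓝 x₀, u x ≤ (h x : EReal)) ∧ ∀ q, dominativeOp n p q (hessian h x₀) ≤ 0 := by
  have hreal : ((u x₀).toReal : EReal) = u x₀ := EReal.coe_toReal hx₀.ne (hu.ne_bot x₀ trivial)
  rcases eq_or_ne x₀ 0 with rfl | h0
  · refine ⟨fun _ => (u 0).toReal, contDiffAt_const, hreal, Filter.Eventually.of_forall fun x => ?_,
      fun q => ?_⟩
    · rw [hreal]
      exact hu.le_zero_of_radial hp hr x
    · exact dominativeOp_radial_nonpos (z := 0) (Φ := fun _ => (u 0).toReal) (Φ₁ := fun _ => 0)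
        (Φ₂ := 0) hn hp contDiffAt_const (Filter.Eventually.of_forall fun s => hasDerivAt_const _ _)
        (hasDerivAt_const _ _) le_rfl (by simp) (by simp) q
  · obtain ⟨g, hg, hg2, hgw⟩ := exists_profile (n := n) hp
    obtain ⟨C, hC, h⟩ := hu.exists_support hn hp hr hg hg2 h0
    have hs : 0 < ‖x₀ - 0‖ ^ 2 := by
      rw [sub_zero]
      have := norm_pos_iff.2 h0
      positivity
    let Φ : ℝ → ℝ := fun s => C * g s + 0 * s + ((u x₀).toReal - C * g (‖x₀‖ ^ 2))
    have hΦ2 : ContDiffAt ℝ 2 Φ (‖x₀ - 0‖ ^ 2) :=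
      ((contDiffAt_const.mul (hg2 _ hs)).add (contDiffAt_const.mul contDiffAt_id)).add
        contDiffAt_const
    have hγ := profileExponent_pos hn hp
    refine ⟨fun x => Φ (‖x - 0‖ ^ 2), contDiffAt_radial hΦ2, ?_, ?_, fun q => ?_⟩
    · simp only [Φ, sub_zero]
      conv_rhs => rw [← hreal]
      norm_cast
      ring
    · filter_upwards [isOpen_ne.mem_nhds h0] with x hx
      refine (h x hx).trans (le_of_eq ?_)
      simp only [Φ, sub_zero]
      norm_cast
      ring
    · refine dominativeOp_radial_nonpos
        (Φ₁ := fun s => C * (-(1 / 2) * s ^ (-profileExponent n p)) + 0)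
        (Φ₂ := C * (profileExponent n p / 2 * (‖x₀ - 0‖ ^ 2) ^ (-profileExponent n p - 1)))
        hn hp hΦ2 ((eventually_gt_nhds hs).mono fun s hs => hasDerivAt_affine_profile hg C 0 _ hs)
        (((hasDerivAt_neg_half_rpow _ hs).const_mul C).add_const 0) (by positivity) ?_ ?_ q
      · intro h
        simp only [profile_top_identity h hs, mul_zero, le_refl]
      · intro h
        simp only [profile_finite_identity hp h hs, mul_zero, le_refl]

lemma DominativeSuperharmonic.radial_add (hn : 0 < n) (hp : 2 ≤ p)
    (hu : PSuperharmonic p Set.univ u) (hr : IsRadial u)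
    (hv : DominativeSuperharmonic p Set.univ v) :
    DominativeSuperharmonic p Set.univ (fun x => u x + v x) := by
  have hub : ∀ x, u x ≠ ⊥ := fun x => hu.ne_bot x trivial
  have hvb : ∀ x, v x ≠ ⊥ := fun x => hv.ne_bot x trivial
  refine ⟨fun x _ => by simp [EReal.add_eq_bot_iff, hub, hvb], ?_, ?_, ?_⟩
  · exact hu.lsc.add' hv.lsc fun x _ =>
      EReal.continuousAt_add (Or.inr (hvb x)) (Or.inl (hub x))
  · have hd : Dense {x : EuclideanSpace ℝ (Fin n) | x ∈ Set.univ ∧ v x < ⊤} := fun x =>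
      hv.finite_dense trivial
    -- Positive dimension rules out isolated points, so deleting the origin, where `u` may be
    -- infinite, preserves density.
    have : Nonempty (Fin n) := ⟨⟨0, hn⟩⟩
    intro x _
    refine closure_mono ?_ ((hd.sdiff_singleton (0 : EuclideanSpace ℝ (Fin n))) x)
    rintro y ⟨⟨-, hy⟩, hy0⟩
    exact ⟨trivial, EReal.add_lt_top (hu.lt_top_of_radial hp hr hy0).ne hy.ne⟩
  · intro x₀ _ φ hφ hφ₀ hφle
    have hux : u x₀ ≠ ⊤ := by
      intro h
      rw [h, EReal.top_add_of_ne_bot (hvb x₀)] at hφ₀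
      exact EReal.coe_ne_top _ hφ₀
    obtain ⟨h, hh, hh₀, hle, hop⟩ := hu.exists_contDiffAt_touching hn hp hr hux.lt_top
    have hφh : ContDiffAt ℝ 2 (fun x => φ x + -h x) x₀ := hφ.add hh.neg
    have h1 : dominativeOp n p (gradient (fun x => φ x + -h x) x₀)
        (hessian (fun x => φ x + -h x) x₀) ≤ 0 := by
      refine hv.test_below x₀ trivial _ hφh ?_ ?_
      · have hvx : v x₀ ≠ ⊤ := by
          intro h
          rw [h, EReal.add_top_of_ne_bot (hub x₀)] at hφ₀
          exact EReal.coe_ne_top _ hφ₀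
        rw [← hh₀, ← EReal.coe_toReal hvx (hvb x₀)] at hφ₀
        rw [← EReal.coe_toReal hvx (hvb x₀)]
        norm_cast at hφ₀ ⊢
        rw [hφ₀]
        ring
      · filter_upwards [hφle, hle] with x hx1 hx2
        have hx3 := hx1.trans (add_le_add_left hx2 (v x))
        rcases eq_or_ne (v x) ⊤ with hvx | hvx
        · rw [hvx]
          exact le_top
        · rw [← EReal.coe_toReal hvx (hvb x)] at hx3 ⊢
          norm_cast at hx3 ⊢
          linarith
    have h2 : hessian φ x₀ = hessian (fun x => φ x + -h x) x₀ + hessian h x₀ := by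
      rw [← hessian_add hφh hh]
      congr 1
      ext x
      ring
    rw [h2]
    exact (dominativeOp_add_le hn hp (hessian_isSymm hφh) (hessian_isSymm hh) _ _ _).trans
      (add_nonpos h1 (hop 0))

end Touching

/-! ### Domination, nesting and invariance -/

section Properties

variable {n : ℕ} {p : ℝ≥0∞} {Ω : Set (EuclideanSpace ℝ (Fin n))}
  {u : EuclideanSpace ℝ (Fin n) → EReal}

lemma DominativeSuperharmonic.pSuperharmonic (hn : 0 < n) (hp : 2 ≤ p)
    (hu : DominativeSuperharmonic p Ω u) : PSuperharmonic p Ω u :=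
  { hu with
    test_below := fun x₀ hx₀ φ hφ h₀ hle =>
      pLaplaceOp_nonpos_of_dominativeOp_nonpos hn hp (hessian_isSymm hφ)
        (hu.test_below x₀ hx₀ φ hφ h₀ hle) }

lemma DominativeSuperharmonic.mono_exponent (hn : 0 < n) (hu : DominativeSuperharmonic p Ω u)
    {q : ℝ≥0∞} (hq : 2 ≤ q) (hqp : q ≤ p) : DominativeSuperharmonic q Ω u :=
  { hu with
    test_below := fun x₀ hx₀ φ hφ h₀ hle =>
      dominativeOp_nonpos_of_le hn hq hqp (hessian_isSymm hφ)
        (hu.test_below x₀ hx₀ φ hφ h₀ hle) }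

lemma DominativeSubsolution.mono_exponent (hn : 0 < n) (hp : 2 ≤ p)
    (hu : DominativeSubsolution p Ω u) {q : ℝ≥0∞} (hpq : p ≤ q) : DominativeSubsolution q Ω u :=
  { hu with
    test_above := fun x₀ hx₀ φ hφ h₀ hle =>
      dominativeOp_nonneg_of_le hn hp hpq (hessian_isSymm hφ)
        (hu.test_above x₀ hx₀ φ hφ h₀ hle) }

lemma PSubharmonic.dominativeSubsolution_two (hu : PSubharmonic 2 Ω u) :
    DominativeSubsolution 2 Ω u :=
  { hu with
    test_above := fun x₀ hx₀ φ hφ h₀ hle => by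
      rw [← pLaplaceOp_two]
      exact hu.test_above x₀ hx₀ φ hφ h₀ hle }

/-- A test function touching from below inherits the nonpositive second differences of `u` at the
touching point, in every direction. -/
lemma LocallyConcaveOn.dominativeSuperharmonic_top (hn : 0 < n)
    {u : EuclideanSpace ℝ (Fin n) → ℝ} (hu : LocallyConcaveOn Ω u) :
    DominativeSuperharmonic ∞ Ω (fun x => (u x : EReal)) := by
  refine ⟨fun _ _ => EReal.coe_ne_bot _, fun x hx => ?_, fun x hx => ?_, ?_⟩
  · obtain ⟨r, hr, -, hc⟩ := hu x hx
    have h1 := (hc.continuousOn Metric.isOpen_ball).continuousAt (Metric.ball_mem_nhds x hr)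
    exact (continuous_coe_real_ereal.continuousAt.comp h1).lowerSemicontinuousAt
      |>.lowerSemicontinuousWithinAt _
  · exact subset_closure ⟨hx, EReal.coe_lt_top _⟩
  · intro x₀ hx₀ φ hφ h₀ hle
    rw [EReal.coe_eq_coe_iff] at h₀
    obtain ⟨r, hr, -, hc⟩ := hu x₀ hx₀
    rw [dominativeOp, if_pos rfl]
    refine largestEigenvalue_le hn (hessian_isSymm hφ) fun q => ?_
    rw [zero_mul, dotProduct_hessian_mulVec]
    refine fderiv_fderiv_nonpos_of_second_difference hφ q ?_
    have hball := Metric.ball_mem_nhds x₀ hr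
    filter_upwards [(tendsto_add_smul x₀ q).eventually hle,
      (tendsto_add_smul x₀ (-q)).eventually hle, (tendsto_add_smul x₀ q).eventually hball,
      (tendsto_add_smul x₀ (-q)).eventually hball] with t h1 h2 h3 h4
    rw [EReal.coe_le_coe_iff] at h1 h2
    have h5 := hc.2 h3 h4 (by norm_num : (0 : ℝ) ≤ 1 / 2) (by norm_num : (0 : ℝ) ≤ 1 / 2)
      (by norm_num)
    have h6 : (1 / 2 : ℝ) • (x₀ + t • q) + (1 / 2 : ℝ) • (x₀ + t • -q) = x₀ := by module
    rw [h6, smul_eq_mul, smul_eq_mul] at h5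
    linarith

lemma DominativeSuperharmonic.comp_isometry (hu : DominativeSuperharmonic p Set.univ u)
    {T : EuclideanSpace ℝ (Fin n) → EuclideanSpace ℝ (Fin n)} (hT : Isometry T) :
    DominativeSuperharmonic p Set.univ (u ∘ T) := by
  -- Strict convexity of the norm makes an isometry affine, and equality of finite dimensions makes
  -- it onto.
  obtain ⟨S, rfl⟩ : ∃ S : EuclideanSpace ℝ (Fin n) ≃ᵃⁱ[ℝ] EuclideanSpace ℝ (Fin n), S = T :=
    ⟨hT.affineIsometryOfStrictConvexSpace.toAffineIsometryEquiv rfl, rfl⟩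
  refine ⟨fun x _ => hu.ne_bot (S x) trivial, ?_, fun x _ => ?_, ?_⟩
  · rw [lowerSemicontinuousOn_univ_iff]
    exact (lowerSemicontinuousOn_univ_iff.1 hu.lsc).comp S.continuous
  · have hd : Dense {x : EuclideanSpace ℝ (Fin n) | x ∈ Set.univ ∧ u x < ⊤} := fun x =>
      hu.finite_dense trivial
    exact (hd.preimage S.toHomeomorph.isOpenMap) x
  · intro x₀ _ φ hφ h₀ hle
    have hinv : ∀ x, S.symm (S x) = x := S.symm_apply_apply
    have hφ' : ContDiffAt ℝ 2 (φ ∘ S.symm) (S x₀) := by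
      refine ContDiffAt.comp _ (by rwa [hinv]) ?_
      exact (S.symm.toAffineIsometry.toContinuousAffineMap.contDiff).contDiffAt
    have hcomp : φ = (φ ∘ S.symm) ∘ S := by
      ext x
      simp
    have h1 : dominativeOp n p (gradient (φ ∘ S.symm) (S x₀))
        (hessian (φ ∘ S.symm) (S x₀)) ≤ 0 := by
      refine hu.test_below (S x₀) trivial _ hφ' (by simpa using h₀) ?_
      have hc : Filter.Tendsto S.symm (𝓝 (S x₀)) (𝓝 x₀) := by
        simpa using S.symm.continuous.tendsto (S x₀)
      filter_upwards [hc.eventually hle] with x hx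
      simpa using hx
    obtain ⟨P, hP, h2⟩ := hessian_comp_affineIsometryEquiv S hφ'
    rw [← hcomp] at h2
    rw [h2]
    exact (dominativeOp_conj hP p _ _).trans_le h1

end Properties

end DominativeLaplace

theorem proposition4p3 (n : ℕ) (hn : 2 ≤ n) (p : ℝ≥0∞) (hp : 2 ≤ p) :
    -- (1) Domination
    (∀ (Ω : Set (EuclideanSpace ℝ (Fin n))) (u : EuclideanSpace ℝ (Fin n) → EReal),
      IsOpen Ω → DominativeSuperharmonic p Ω u → PSuperharmonic p Ω u) ∧
    -- (2) Sublinearity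
    (∀ u v : EuclideanSpace ℝ (Fin n) → EReal,
      DominativeSuperharmonic p Set.univ u → DominativeSuperharmonic p Set.univ v →
      IsRadial u → DominativeSuperharmonic p Set.univ (fun x => u x + v x)) ∧
    -- (3) Radial equivalence
    (∀ u : EuclideanSpace ℝ (Fin n) → EReal,
      IsRadial u → PSuperharmonic p Set.univ u → DominativeSuperharmonic p Set.univ u) ∧
    -- (4) Nesting property
    (∀ (Ω : Set (EuclideanSpace ℝ (Fin n))) (u : EuclideanSpace ℝ (Fin n) → EReal),
      IsOpen Ω → DominativeSuperharmonic p Ω u →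
      ∀ q : ℝ≥0∞, 2 ≤ q → q ≤ p → DominativeSuperharmonic q Ω u) ∧
    (∀ (Ω : Set (EuclideanSpace ℝ (Fin n))) (u : EuclideanSpace ℝ (Fin n) → ℝ),
      IsOpen Ω → LocallyConcaveOn Ω u →
      ∀ q : ℝ≥0∞, 2 ≤ q → DominativeSuperharmonic q Ω (fun x => (u x : EReal))) ∧
    (∀ (Ω : Set (EuclideanSpace ℝ (Fin n))) (u : EuclideanSpace ℝ (Fin n) → EReal),
      IsOpen Ω → DominativeSubsolution p Ω u →
      ∀ q : ℝ≥0∞, p ≤ q → DominativeSubsolution q Ω u) ∧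
    (∀ (Ω : Set (EuclideanSpace ℝ (Fin n))) (u : EuclideanSpace ℝ (Fin n) → EReal),
      IsOpen Ω → PSubharmonic 2 Ω u →
      ∀ q : ℝ≥0∞, 2 ≤ q → DominativeSubsolution q Ω u) ∧
    -- (5) Invariance under isometries
    (∀ (u : EuclideanSpace ℝ (Fin n) → EReal)
      (T : EuclideanSpace ℝ (Fin n) → EuclideanSpace ℝ (Fin n)),
      DominativeSuperharmonic p Set.univ u → Isometry T →
      DominativeSuperharmonic p Set.univ (u ∘ T)) ∧
    -- (6) Radial `p`-superharmonic functions are touched from above by fundamental solutions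
    (∀ u : EuclideanSpace ℝ (Fin n) → EReal,
      IsRadial u → PSuperharmonic p Set.univ u →
      ∀ x₀ : EuclideanSpace ℝ (Fin n), u x₀ < ⊤ →
      ∃ C₁ C₂ : ℝ, 0 ≤ C₁ ∧
        (C₁ : EReal) * fundamentalSolution n p x₀ + (C₂ : EReal) = u x₀ ∧
        ∀ᶠ x in 𝓝 x₀, u x ≤ (C₁ : EReal) * fundamentalSolution n p x + (C₂ : EReal)) := by
  have hn0 : 0 < n := by omega
  -- The zero function serves as `v` in `DominativeSuperharmonic.radial_add` to give the radial
  -- equivalence.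
  have hconst : DominativeSuperharmonic (n := n) p Set.univ (fun _ => ((0 : ℝ) : EReal)) :=
    (LocallyConcaveOn.dominativeSuperharmonic_top hn0 (u := fun _ => 0) fun _ _ =>
      ⟨1, one_pos, Set.subset_univ _, concaveOn_const _ (convex_ball _ _)⟩).mono_exponent
      hn0 hp le_top
  refine ⟨fun Ω u _ hu => hu.pSuperharmonic hn0 hp, fun u v hu hv hr =>
    .radial_add hn0 hp (hu.pSuperharmonic hn0 hp) hr hv, fun u hr hu => ?_,
    fun Ω u _ hu q hq hqp => hu.mono_exponent hn0 hq hqp,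
    fun Ω u _ hu q hq => hu.dominativeSuperharmonic_top hn0 |>.mono_exponent hn0 hq le_top,
    fun Ω u _ hu q hpq => hu.mono_exponent hn0 hp hpq,
    fun Ω u _ hu q hq => hu.dominativeSubsolution_two.mono_exponent hn0 le_rfl hq,
    fun u T hu hT => hu.comp_isometry hT,
    fun u hr hu x₀ hx₀ => hu.exists_fundamentalSolution_touching hn0 hp hr hx₀⟩
  simpa using DominativeSuperharmonic.radial_add hn0 hp hu hr hconst
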